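/- **Theorem (HOMFULL is GI-hard).** An *oriented graph* is a finite digraph without loops and without directed 2-cycles. A *homomorphic image* of an oriented graph $G$ is an oriented graph $H$ admitting a map $V(G)\to V(H)$ that sends arcs to arcs and is surjective both on vertices and on arcs; $G$ is *homomorphically full* if each of its homomorphic images is isomorphic to a (not necessarily induced) subgraph of $G$. An *oriented clique* is an oriented graph in which any two distinct non-adjacent vertices are the ends of a directed path of length $2$. Graphs are given by adjacency matrices. 1. The problem HOMFULL (given an oriented graph $G$, is $G$ homomorphically full?) is GI-hard: there is a polynomial-time many-one reduction from the graph isomorphism problem to HOMFULL. 2. For oriented graphs $G_1,G_2$ let $\hat G$ be the oriented graph formed from the disjoint union of a copy of $G_1$, two copies $G_2,G_2'$ of $G_2$, a new vertex $q$, and the oriented graph $J$ with vertices $u,u',v,v',w$ and arcs $wu,\ wu',\ uv,\ u'v,\ u'v',\ vw,\ v'w$, by adding the arcs - $qx$ for all $x\in V(J)$, and $yq$ for all $y\in V(G_1)\cup V(G_2)\cup V(G_2')$; - $y_1y_2$, $y_2y_2'$ and $y_2'y_1$ for all $y_1\in V(G_1)$, $y_2\in V(G_2)$, $y_2'\in V(G_2')$;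 - $wy_1$, $vy_2$ and $uy_2'$ for all $y_1\in V(G_1)$, $y_2\in V(G_2)$, $y_2'\in V(G_2')$. If $G_1$ and $G_2$ are oriented cliques, each with at least one vertex, then $G_1\cong G_2$ if and only if $\hat G$ is homomorphically full. Moreover $(G_1,G_2)\mapsto\hat G$ (with the vertices of $\hat G$ suitably numbered) is computable in polynomial time, and so is a polynomial-time many-one reduction to HOMFULL from the problem of deciding whether two given (non-empty) oriented cliques are isomorphic. -/

import Mathlib

/-! ### Oriented graphs, homomorphisms, homomorphic images -/

/-- An oriented graph: a digraph without loops and without directed 2-cycles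
(both are excluded by asymmetry of the arc relation). -/
structure OrientedGraph (V : Type*) extends Digraph V where
  asymm : ∀ x y, Adj x y → ¬ Adj y x

namespace OrientedGraph

universe u v

variable {V : Type u} {W : Type v}

/-- `φ` is a complete homomorphism `G → H`: it preserves arcs, and it is surjective both on
vertices and on arcs. -/
structure IsCompleteHom (G : OrientedGraph V) (H : OrientedGraph W) (φ : V → W) : Prop where
  map_arc : ∀ x y, G.Adj x y → H.Adj (φ x) (φ y)
  surj_vertex : Function.Surjective φ
  surj_arc : ∀ a b, H.Adj a b → ∃ x y, G.Adj x y ∧ φ x = a ∧ φ y = b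

/-- The oriented graph `H` is a homomorphic image of the oriented graph `G`. -/
def IsHomImage (G : OrientedGraph V) (H : OrientedGraph W) : Prop :=
  ∃ φ : V → W, IsCompleteHom G H φ

/-- `H` is isomorphic to a (not necessarily induced) subgraph of `G`. -/
def IsoToSubgraph (H : OrientedGraph W) (G : OrientedGraph V) : Prop :=
  ∃ ψ : W → V, Function.Injective ψ ∧ ∀ a b, H.Adj a b → G.Adj (ψ a) (ψ b)

/-- `G` is homomorphically full (as an oriented graph): every oriented graph that is a
homomorphic image of `G` is isomorphic to a subgraph of `G`. -/
def HomFull (G : OrientedGraph V) : Prop :=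
  ∀ (W : Type u) (H : OrientedGraph W), IsHomImage G H → IsoToSubgraph H G

/-- `G ≅ H`: there is a bijection of the vertices that preserves and reflects arcs. -/
def Isomorphic (G : OrientedGraph V) (H : OrientedGraph W) : Prop :=
  Nonempty (G.Adj ≃r H.Adj)

/-- An oriented clique: any two distinct non-adjacent vertices are the ends of a directed path
of length 2 (in one direction or the other). -/
def IsOrientedClique (G : OrientedGraph V) : Prop :=
  ∀ x y, x ≠ y → ¬ G.Adj x y → ¬ G.Adj y x →
    ∃ z, (G.Adj x z ∧ G.Adj z y) ∨ (G.Adj y z ∧ G.Adj z x)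

end OrientedGraph

/-! ### The gadget -/

/-- The vertices of the five-vertex oriented graph `J`. -/
inductive JVertex : Type
  | u | u' | v | v' | w

/-- The seven arcs of `J`. -/
inductive JArc : JVertex → JVertex → Prop
  | wu : JArc .w .u
  | wu' : JArc .w .u'
  | uv : JArc .u .v
  | u'v : JArc .u' .v
  | u'v' : JArc .u' .v'
  | vw : JArc .v .w
  | v'w : JArc .v' .w

/-- The oriented graph `J`. -/
def JGraph : OrientedGraph JVertex where
  Adj := JArc
  asymm := by
    intro x y h h'
    cases h <;> cases h'

/-- The vertices of the gadget: those of `J`, the new vertex `q`, those of a copy of `G₁`, and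
those of two copies of `G₂` (the second copy being the primed one). -/
inductive GadgetVertex (V₁ V₂ : Type*)
  | j (x : JVertex)
  | q
  | y₁ (a : V₁)
  | y₂ (b : V₂)
  | y₂' (b : V₂)

/-- The arcs of the gadget. -/
inductive GadgetArc {V₁ V₂ : Type*} (G₁ : OrientedGraph V₁) (G₂ : OrientedGraph V₂) :
    GadgetVertex V₁ V₂ → GadgetVertex V₁ V₂ → Prop
  | inJ (x y : JVertex) : JGraph.Adj x y → GadgetArc G₁ G₂ (.j x) (.j y)
  | inG₁ (a b : V₁) : G₁.Adj a b → GadgetArc G₁ G₂ (.y₁ a) (.y₁ b)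
  | inG₂ (a b : V₂) : G₂.Adj a b → GadgetArc G₁ G₂ (.y₂ a) (.y₂ b)
  | inG₂' (a b : V₂) : G₂.Adj a b → GadgetArc G₁ G₂ (.y₂' a) (.y₂' b)
  | qJ (x : JVertex) : GadgetArc G₁ G₂ .q (.j x)
  | y₁q (a : V₁) : GadgetArc G₁ G₂ (.y₁ a) .q
  | y₂q (a : V₂) : GadgetArc G₁ G₂ (.y₂ a) .q
  | y₂'q (a : V₂) : GadgetArc G₁ G₂ (.y₂' a) .q
  | y₁y₂ (a : V₁) (b : V₂) : GadgetArc G₁ G₂ (.y₁ a) (.y₂ b)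
  | y₂y₂' (a b : V₂) : GadgetArc G₁ G₂ (.y₂ a) (.y₂' b)
  | y₂'y₁ (a : V₂) (b : V₁) : GadgetArc G₁ G₂ (.y₂' a) (.y₁ b)
  | wy₁ (a : V₁) : GadgetArc G₁ G₂ (.j .w) (.y₁ a)
  | vy₂ (a : V₂) : GadgetArc G₁ G₂ (.j .v) (.y₂ a)
  | uy₂' (a : V₂) : GadgetArc G₁ G₂ (.j .u) (.y₂' a)

/-- The gadget built from `J`, one copy of `G₁` and two copies of `G₂`. -/
def gadget {V₁ V₂ : Type*} (G₁ : OrientedGraph V₁) (G₂ : OrientedGraph V₂) :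
    OrientedGraph (GadgetVertex V₁ V₂) where
  Adj := GadgetArc G₁ G₂
  asymm := by
    intro x y h h'
    cases h with
    | inJ x y h => cases h' with | inJ _ _ k => exact JGraph.asymm _ _ h k
    | inG₁ a b h => cases h' with | inG₁ _ _ k => exact G₁.asymm _ _ h k
    | inG₂ a b h => cases h' with | inG₂ _ _ k => exact G₂.asymm _ _ h k
    | inG₂' a b h => cases h' with | inG₂' _ _ k => exact G₂.asymm _ _ h k
    | _ => cases h'

/-! ### Adjacency-matrix encodings of finite graphs -/

open Classical in
/-- The adjacency matrix of a relation on `Fin n`, written row by row; every row is a string of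
`n` bits followed by the end-of-row marker `none`. -/
noncomputable def encodeMatrix (n : ℕ) (A : Fin n → Fin n → Prop) : List (Option Bool) :=
  (List.finRange n).flatMap fun i =>
    (List.finRange n).map (fun k => some (decide (A i k))) ++ [none]

theorem count_none_encodeMatrix (n : ℕ) (A : Fin n → Fin n → Prop) :
    (encodeMatrix n A).count none = n := by
  classical
  have h : ∀ (l : List (Fin n)) (i : Fin n),
      ((l.map fun k => some (decide (A i k)))).count none = 0 := by
    intro l i
    rw [List.count_eq_zero]
    simp
  simp [encodeMatrix, List.count_flatMap, Function.comp_def, h]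

theorem encodeMatrix_injective {n : ℕ} {A B : Fin n → Fin n → Prop}
    (h : encodeMatrix n A = encodeMatrix n B) : A = B := by
  classical
  have key : ∀ l : List (Fin n),
      (l.flatMap fun i =>
        (List.finRange n).map (fun k => some (decide (A i k))) ++ [none]) =
      (l.flatMap fun i =>
        (List.finRange n).map (fun k => some (decide (B i k))) ++ [none]) →
      ∀ i ∈ l, ∀ k, A i k ↔ B i k := by
    intro l
    induction l with
    | nil => simp
    | cons a l ih =>
      intro hl
      rw [List.flatMap_cons, List.flatMap_cons] at hl
      obtain ⟨h1, h2⟩ := List.append_inj hl (by simp)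
      have h3 := List.append_cancel_right h1
      intro i hi k
      rcases List.mem_cons.1 hi with rfl | hi
      · have := List.map_inj_left.1 h3 k (List.mem_finRange k)
        simpa using this
      · exact ih h2 i hi k
  funext i k
  exact propext (key _ h i (List.mem_finRange i) k)

/-- A finite simple graph on a vertex set `{0, …, n - 1}`. -/
def FinGraph : Type := Σ n : ℕ, SimpleGraph (Fin n)

/-- A finite oriented graph on a vertex set `{0, …, n - 1}`. -/
def FinOrientedGraph : Type := Σ n : ℕ, OrientedGraph (Fin n)

/-- Every injective map into strings is an encoding. -/
noncomputable def encodingOfInjective {α Γ : Type} (e : α → List Γ)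
    (he : Function.Injective e) : Computability.Encoding α Γ where
  encode := e
  decode := Function.partialInv e
  decode_encode := Function.partialInv_left he

/-- Finite simple graphs encoded by their adjacency matrices. -/
noncomputable def encodingFinGraph : Computability.Encoding FinGraph (Option Bool) :=
  encodingOfInjective (fun G => encodeMatrix G.1 G.2.Adj) (by
    rintro ⟨n, G⟩ ⟨m, H⟩ h
    dsimp only at h
    have hnm : n = m := by
      rw [← count_none_encodeMatrix n G.Adj, h, count_none_encodeMatrix]
    subst hnm
    rw [SimpleGraph.ext (encodeMatrix_injective h)])

/-- Finite oriented graphs encoded by their adjacency matrices. -/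
noncomputable def encodingFinOrientedGraph :
    Computability.Encoding FinOrientedGraph (Option Bool) :=
  encodingOfInjective (fun G => encodeMatrix G.1 G.2.Adj) (by
    rintro ⟨n, ⟨⟨A⟩, hA⟩⟩ ⟨m, ⟨⟨B⟩, hB⟩⟩ h
    dsimp only at h
    have hnm : n = m := by
      rw [← count_none_encodeMatrix n A, h, count_none_encodeMatrix]
    subst hnm
    have hAB : A = B := encodeMatrix_injective h
    subst hAB
    rfl)

/-! ### Decision problems and polynomial-time many-one reductions -/

/-- A decision problem: instances, encoded as strings over a finite alphabet, and the set of
yes-instances. -/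
structure DecisionProblem where
  Inst : Type
  Alphabet : Type
  alphabetFin : Fintype Alphabet
  encoding : Computability.Encoding Inst Alphabet
  Yes : Inst → Prop

/-- `f` is computed by a Turing machine in time polynomial in the length of the encoded
instance. -/
def PolyTimeComputable (P Q : DecisionProblem) (f : P.Inst → Q.Inst) : Prop :=
  Nonempty (Turing.TM2ComputableInPolyTime P.encoding.encode Q.encoding.encode f)

/-- `f` is a polynomial-time many-one reduction of `P` to `Q`. -/
def IsPolyTimeReduction (P Q : DecisionProblem) (f : P.Inst → Q.Inst) : Prop :=
  PolyTimeComputable P Q f ∧ ∀ x, P.Yes x ↔ Q.Yes (f x)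

/-- The graph isomorphism problem. -/
noncomputable def GRAPHISO : DecisionProblem where
  Inst := FinGraph × FinGraph
  Alphabet := Option Bool ⊕ Option Bool
  alphabetFin := inferInstance
  encoding := Computability.encodingProd encodingFinGraph encodingFinGraph
  Yes p := Nonempty (p.1.2 ≃g p.2.2)

/-- A decision problem is GI-hard if the graph isomorphism problem reduces to it in
polynomial time. -/
def GIHard (P : DecisionProblem) : Prop :=
  ∃ f : GRAPHISO.Inst → P.Inst, IsPolyTimeReduction GRAPHISO P f

/-- Instance: an oriented graph `G`. Question: is `G` homomorphically full? -/
noncomputable def HOMFULL : DecisionProblem where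
  Inst := FinOrientedGraph
  Alphabet := Option Bool
  alphabetFin := inferInstance
  encoding := encodingFinOrientedGraph
  Yes G := G.2.HomFull

/-- A pair of finite oriented cliques, each with at least one vertex. -/
def OCliquePair : Type :=
  {p : FinOrientedGraph × FinOrientedGraph //
    (0 < p.1.1 ∧ p.1.2.IsOrientedClique) ∧ (0 < p.2.1 ∧ p.2.2.IsOrientedClique)}

/-- Instance: a pair of oriented cliques. Question: are they isomorphic? -/
noncomputable def OCLIQUEISO : DecisionProblem where
  Inst := OCliquePair
  Alphabet := Option Bool ⊕ Option Bool
  alphabetFin := inferInstance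
  encoding := encodingOfInjective
    (fun p => (Computability.encodingProd encodingFinOrientedGraph
      encodingFinOrientedGraph).encode p.1)
    ((Computability.encodingProd encodingFinOrientedGraph
      encodingFinOrientedGraph).encode_injective.comp Subtype.val_injective)
  Yes p := p.1.1.2.Isomorphic p.1.2.2

/-! A homomorphism between oriented graphs never identifies the ends of an arc or of a directed path
of length 2. In the gadget over two oriented cliques this leaves only the pairs `u`, `u'` and `v`,
`v'` (`mergeable_of_map_eq`). Homomorphic fullness asks for an endomorphism with the same kernel as
each complete homomorphism (`homFull_iff`), so only four kernels matter. The identity, `foldV` and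
`foldUV` realise three of them for arbitrary `G₁` and `G₂`. Identifying `u` with `u'` alone forces a
rotation of `J`, which carries `G₁` to `G₂`, `G₂` to `G₂'` and `G₂'` to `G₁`. An isomorphism
supplies such a rotation (`foldU`). Conversely, an endomorphism with this kernel fixes `q` and must
rotate in this way, so it yields injective homomorphisms between `G₁` and `G₂` in both directions;
for finite graphs these give an isomorphism (`isomorphic_of_gadget_homFull`).

For GI-hardness, a simple graph is turned into an oriented clique that determines it: the arcs
between the vertices `a x` and `b y` record adjacency, and a source `s`, a sink `t` and the vertices
`c x` make the classes and the matching between them recognisable (`cliqueGraph_isomorphic_iff`).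

Polynomial time is proved for actual Turing machines. A small loop language over stacks, with a
step-counting semantics, is compiled to `FinTM2` (`Runs.steps`, `Runs.outputsInTime`). Both
constructions produce matrices made of copied rows, complemented rows, constant blocks and diagonal
blocks, which programs in this language write in quadratic time (`cliqueRows_emits`,
`gadgetRows_emits`). -/

namespace OrientedGraph

-- Homomorphic fullness, isomorphism and induced graphs.

universe u v

/-- Composing a complete homomorphism with an embedding of its image gives an endomorphism with the
same kernel. Conversely, such an endomorphism factors through a section of `φ`, and arc-surjectivity
makes the factor arc-preserving. -/
theorem homFull_iff {V : Type u} (G : OrientedGraph V) :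
    G.HomFull ↔ ∀ (W : Type u) (H : OrientedGraph W) (φ : V → W), IsCompleteHom G H φ →
      ∃ r : V → V, (∀ x y, G.Adj x y → G.Adj (r x) (r y)) ∧ ∀ x y, r x = r y ↔ φ x = φ y := by
  constructor
  · intro hG W H φ hφ
    obtain ⟨ψ, hψ, hψa⟩ := hG W H ⟨φ, hφ⟩
    exact ⟨ψ ∘ φ, fun x y h => hψa _ _ (hφ.map_arc _ _ h), fun x y => hψ.eq_iff⟩
  · rintro hG W H ⟨φ, hφ⟩
    obtain ⟨r, hr, hk⟩ := hG W H φ hφ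
    have hs : ∀ x, r (Function.surjInv hφ.surj_vertex (φ x)) = r x := fun x =>
      (hk _ _).2 (Function.surjInv_eq hφ.surj_vertex (φ x))
    refine ⟨r ∘ Function.surjInv hφ.surj_vertex, fun a b h => ?_, fun a b h => ?_⟩
    · have := (hk _ _).1 h
      rwa [Function.surjInv_eq hφ.surj_vertex a, Function.surjInv_eq hφ.surj_vertex b] at this
    · obtain ⟨x, y, hxy, rfl, rfl⟩ := hφ.surj_arc a b h
      simpa only [Function.comp, hs] using hr x y hxy

theorem HomFull.of_isomorphic {V W : Type u} {G : OrientedGraph V} {H : OrientedGraph W}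
    (hG : G.HomFull) (h : G.Isomorphic H) : H.HomFull := by
  obtain ⟨e⟩ := h
  rintro X K ⟨φ, hφ⟩
  obtain ⟨ψ, hψ, hψa⟩ := hG X K ⟨φ ∘ e, fun x y h => hφ.map_arc _ _ (e.map_rel_iff.2 h),
    hφ.surj_vertex.comp e.surjective, fun a b h => by
      obtain ⟨x, y, hxy, rfl, rfl⟩ := hφ.surj_arc a b h
      exact ⟨e.symm x, e.symm y, e.symm.map_rel_iff.2 hxy, by simp, by simp⟩⟩
  exact ⟨e ∘ ψ, e.injective.comp hψ, fun a b h => e.map_rel_iff.2 (hψa a b h)⟩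

theorem Isomorphic.symm {V : Type u} {W : Type v} {G : OrientedGraph V} {H : OrientedGraph W}
    (h : G.Isomorphic H) : H.Isomorphic G := h.map RelIso.symm

theorem homFull_congr {V W : Type u} {G : OrientedGraph V} {H : OrientedGraph W}
    (h : G.Isomorphic H) : G.HomFull ↔ H.HomFull :=
  ⟨fun hG => hG.of_isomorphic h, fun hH => hH.of_isomorphic h.symm⟩

/-- Finite oriented graphs that embed in each other as subgraphs are isomorphic. -/
theorem isomorphic_of_injective {V : Type u} {W : Type v} [Finite V] [Finite W]
    {G : OrientedGraph V} {H : OrientedGraph W} {f : V → W} {g : W → V}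
    (hf : Function.Injective f) (hg : Function.Injective g)
    (hfa : ∀ x y, G.Adj x y → H.Adj (f x) (f y)) (hga : ∀ x y, H.Adj x y → G.Adj (g x) (g y)) :
    G.Isomorphic H := by
  have hgf : Function.Bijective (g ∘ f) := Finite.injective_iff_bijective.1 (hg.comp hf)
  have hfb : Function.Bijective f := by
    refine ⟨hf, fun w => ?_⟩
    obtain ⟨x, hx⟩ := hgf.2 (g w)
    exact ⟨x, hg hx⟩
  let e : Equiv.Perm V := Equiv.ofBijective _ hgf
  have he : ∀ x y, G.Adj x y → G.Adj (e x) (e y) := fun x y h => hga _ _ (hfa _ _ h)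
  have hpow : ∀ (n : ℕ) x y, G.Adj x y → G.Adj ((e ^ n) x) ((e ^ n) y) := by
    intro n
    induction n with
    | zero => intro x y h; simpa using h
    | succ n ih => intro x y h; rw [pow_succ]; exact ih _ _ (he _ _ h)
  -- The inverse of a permutation of finite order is one of its powers, so it preserves arcs as
  -- well.
  have hinv : ∀ x y, G.Adj (e x) (e y) → G.Adj x y := by
    intro x y h
    have h1 := hpow (orderOf e - 1) _ _ h
    rwa [← Equiv.Perm.mul_apply, ← Equiv.Perm.mul_apply, pow_sub_one_mul (orderOf_pos e).ne',
      pow_orderOf_eq_one] at h1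
  exact ⟨⟨Equiv.ofBijective f hfb, fun {x y} => ⟨fun h => hinv _ _ (hga _ _ h), hfa x y⟩⟩⟩

/-- The image of an oriented graph under a map that creates no directed 2-cycle. -/
def image {V : Type u} {W : Type v} (G : OrientedGraph V) (φ : V → W)
    (hφ : ∀ x y x' y', G.Adj x y → G.Adj x' y' → φ x = φ y' → φ y = φ x' → False) :
    OrientedGraph W where
  Adj a b := ∃ x y, G.Adj x y ∧ φ x = a ∧ φ y = b
  asymm := by
    rintro _ _ ⟨x, y, h, rfl, rfl⟩ ⟨x', y', h', h1, h2⟩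
    exact hφ x y x' y' h h' h2.symm h1.symm

theorem isCompleteHom_image {V : Type u} {W : Type v} (G : OrientedGraph V) (φ : V → W)
    (hφ : ∀ x y x' y', G.Adj x y → G.Adj x' y' → φ x = φ y' → φ y = φ x' → False)
    (hs : Function.Surjective φ) : IsCompleteHom G (G.image φ hφ) φ :=
  ⟨fun x y h => ⟨x, y, h, rfl, rfl⟩, hs, fun _ _ h => h⟩

/-- The oriented graph induced along an injective map. -/
def comap {V : Type u} {W : Type v} (G : OrientedGraph V) (φ : W → V) : OrientedGraph W where
  Adj a b := G.Adj (φ a) (φ b)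
  asymm _ _ := G.asymm _ _

theorem comap_isomorphic {V : Type u} {W : Type v} (G : OrientedGraph V) (e : W ≃ V) :
    (G.comap e).Isomorphic G :=
  ⟨⟨e, Iff.rfl⟩⟩

theorem Isomorphic.trans {V W X : Type*} {G : OrientedGraph V} {H : OrientedGraph W}
    {K : OrientedGraph X} (h : G.Isomorphic H) (h' : H.Isomorphic K) : G.Isomorphic K := by
  obtain ⟨e⟩ := h
  obtain ⟨e'⟩ := h'
  exact ⟨e.trans e'⟩

theorem IsOrientedClique.of_isomorphic {V W : Type*} {G : OrientedGraph V} {H : OrientedGraph W}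
    (hG : G.IsOrientedClique) (h : H.Isomorphic G) : H.IsOrientedClique := by
  obtain ⟨e⟩ := h
  intro x y hxy h1 h2
  obtain ⟨z, hz⟩ := hG (e x) (e y) (e.injective.ne hxy) (fun h => h1 (e.map_rel_iff.1 h))
    (fun h => h2 (e.map_rel_iff.1 h))
  refine ⟨e.symm z, ?_⟩
  simpa only [← e.map_rel_iff, RelIso.apply_symm_apply] using hz

end OrientedGraph

/-! ### Isomorphic cliques make the gadget homomorphically full. -/

namespace OrientedGraph
section Gadget

variable {V₁ V₂ : Type} {G₁ : OrientedGraph V₁} {G₂ : OrientedGraph V₂}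

open GadgetVertex

/-- The only pairs of vertices of the gadget that a homomorphism can identify. -/
inductive Mergeable : GadgetVertex V₁ V₂ → GadgetVertex V₁ V₂ → Prop
  | rfl (x) : Mergeable x x
  | uu' : Mergeable (j .u) (j .u')
  | u'u : Mergeable (j .u') (j .u)
  | vv' : Mergeable (j .v) (j .v')
  | v'v : Mergeable (j .v') (j .v)

theorem IsOrientedClique.eq_of_map_eq {V W : Type*} {G : OrientedGraph V}
    (hG : G.IsOrientedClique) {φ : V → W} (h1 : ∀ x y, G.Adj x y → φ x ≠ φ y)
    (h2 : ∀ x y z, G.Adj x z → G.Adj z y → φ x ≠ φ y) {x y : V} (h : φ x = φ y) : x = y := by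
  by_contra hne
  obtain ⟨z, ⟨ha, hb⟩ | ⟨ha, hb⟩⟩ := hG x y hne (fun hh => h1 _ _ hh h)
    (fun hh => h1 _ _ hh h.symm)
  · exact h2 _ _ z ha hb h
  · exact h2 _ _ z ha hb h.symm

/-- Every other pair of distinct vertices is joined by an arc or by a directed path of length 2.
Between a copy and `J` the path runs through `q`; inside a copy the clique property provides the arc
or path. -/
theorem mergeable_of_map_eq (hG₁ : G₁.IsOrientedClique) (hG₂ : G₂.IsOrientedClique)
    {W : Type*} {H : OrientedGraph W} {φ : GadgetVertex V₁ V₂ → W}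
    (hφ : ∀ x y, (gadget G₁ G₂).Adj x y → H.Adj (φ x) (φ y)) {x y : GadgetVertex V₁ V₂}
    (h : φ x = φ y) : Mergeable x y := by
  have h1 : ∀ x y, GadgetArc G₁ G₂ x y → φ x ≠ φ y := fun x y ha he => by
    have := hφ x y ha
    rw [he] at this
    exact H.asymm _ _ this this
  have h2 : ∀ x y z, GadgetArc G₁ G₂ x z → GadgetArc G₁ G₂ z y → φ x ≠ φ y :=
      fun x y z ha hb he => by
    have h3 := hφ x z ha
    have h4 := hφ z y hb
    rw [he] at h3
    exact H.asymm _ _ h3 h4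
  have hyq : ∀ x y, GadgetArc G₁ G₂ x .q → φ x ≠ φ (j y) := fun x y hx => h2 _ _ q hx (.qJ y)
  have hJ1 : ∀ x y, JArc x y → φ (j x) ≠ φ (j y) := fun x y ha => h1 _ _ (.inJ _ _ ha)
  have hJ2 : ∀ x y z, JArc x z → JArc z y → φ (j x) ≠ φ (j y) := fun x y z ha hb =>
    h2 _ _ (j z) (.inJ _ _ ha) (.inJ _ _ hb)
  -- The seven arcs, together with the path from `v'` through `w` to `u`, separate eight of the ten
  -- pairs of `J`.
  have hJ : ∀ x y : JVertex, φ (j x) = φ (j y) →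
      Mergeable (j x : GadgetVertex V₁ V₂) (j y) := by
    have e1 := hJ1 _ _ .wu
    have e2 := hJ1 _ _ .wu'
    have e3 := hJ1 _ _ .uv
    have e4 := hJ1 _ _ .u'v
    have e5 := hJ1 _ _ .u'v'
    have e6 := hJ1 _ _ .vw
    have e7 := hJ1 _ _ .v'w
    have e8 := hJ2 _ _ _ .v'w .wu
    intro x y h
    cases x <;> cases y <;>
      first
      | constructor
      | exact absurd h ‹_›
      | exact absurd h.symm ‹_›
  cases x with
  | j x =>
    cases y with
    | j y => exact hJ x y h
    | q => exact absurd h.symm (h1 _ _ (.qJ _))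
    | y₁ b => exact absurd h.symm (hyq _ _ (.y₁q _))
    | y₂ b => exact absurd h.symm (hyq _ _ (.y₂q _))
    | y₂' b => exact absurd h.symm (hyq _ _ (.y₂'q _))
  | q =>
    cases y with
    | j y => exact absurd h (h1 _ _ (.qJ _))
    | q => constructor
    | y₁ b => exact absurd h.symm (h1 _ _ (.y₁q _))
    | y₂ b => exact absurd h.symm (h1 _ _ (.y₂q _))
    | y₂' b => exact absurd h.symm (h1 _ _ (.y₂'q _))
  | y₁ a =>
    cases y with
    | j y => exact absurd h (hyq _ _ (.y₁q _))
    | q => exact absurd h (h1 _ _ (.y₁q _))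
    | y₁ b =>
      obtain rfl := hG₁.eq_of_map_eq (φ := φ ∘ y₁) (fun x y ha => h1 _ _ (.inG₁ _ _ ha))
        (fun x y z ha hb => h2 _ _ _ (.inG₁ _ _ ha) (.inG₁ _ _ hb)) h
      constructor
    | y₂ b => exact absurd h (h1 _ _ (.y₁y₂ _ _))
    | y₂' b => exact absurd h.symm (h1 _ _ (.y₂'y₁ _ _))
  | y₂ a =>
    cases y with
    | j y => exact absurd h (hyq _ _ (.y₂q _))
    | q => exact absurd h (h1 _ _ (.y₂q _))
    | y₁ b => exact absurd h.symm (h1 _ _ (.y₁y₂ _ _))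
    | y₂ b =>
      obtain rfl := hG₂.eq_of_map_eq (φ := φ ∘ y₂) (fun x y ha => h1 _ _ (.inG₂ _ _ ha))
        (fun x y z ha hb => h2 _ _ _ (.inG₂ _ _ ha) (.inG₂ _ _ hb)) h
      constructor
    | y₂' b => exact absurd h (h1 _ _ (.y₂y₂' _ _))
  | y₂' a =>
    cases y with
    | j y => exact absurd h (hyq _ _ (.y₂'q _))
    | q => exact absurd h (h1 _ _ (.y₂'q _))
    | y₁ b => exact absurd h (h1 _ _ (.y₂'y₁ _ _))
    | y₂ b => exact absurd h.symm (h1 _ _ (.y₂y₂' _ _))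
    | y₂' b =>
      obtain rfl := hG₂.eq_of_map_eq (φ := φ ∘ y₂') (fun x y ha => h1 _ _ (.inG₂' _ _ ha))
        (fun x y z ha hb => h2 _ _ _ (.inG₂' _ _ ha) (.inG₂' _ _ hb)) h
      constructor

/-- The folding of the gadget that identifies `v'` with `v`. -/
def foldV : GadgetVertex V₁ V₂ → GadgetVertex V₁ V₂
  | j .v' => j .v
  | x => x

/-- The folding of the gadget that identifies `u'` with `u` and `v'` with `v`. -/
def foldUV : GadgetVertex V₁ V₂ → GadgetVertex V₁ V₂
  | j .u' => j .u
  | j .v' => j .v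
  | x => x

/-- The twisted folding of the gadget that identifies `u'` with `u`. -/
def foldU (f : V₁ → V₂) (g : V₂ → V₁) : GadgetVertex V₁ V₂ → GadgetVertex V₁ V₂
  | j .u => j .w
  | j .u' => j .w
  | j .v => j .u
  | j .v' => j .u'
  | j .w => j .v
  | q => q
  | y₁ a => y₂ (f a)
  | y₂ b => y₂' b
  | y₂' b => y₁ (g b)

theorem foldV_adj (x y : GadgetVertex V₁ V₂) (h : (gadget G₁ G₂).Adj x y) :
    (gadget G₁ G₂).Adj (foldV x) (foldV y) := by
  change GadgetArc G₁ G₂ x y at h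
  change GadgetArc G₁ G₂ _ _
  cases h with
  | inJ x y h =>
    change JArc x y at h
    cases h <;> exact .inJ _ _ (by constructor)
  | qJ x => cases x <;> exact .qJ _
  | _ => constructor <;> assumption

theorem foldUV_adj (x y : GadgetVertex V₁ V₂) (h : (gadget G₁ G₂).Adj x y) :
    (gadget G₁ G₂).Adj (foldUV x) (foldUV y) := by
  change GadgetArc G₁ G₂ x y at h
  change GadgetArc G₁ G₂ _ _
  cases h with
  | inJ x y h =>
    change JArc x y at h
    cases h <;> exact .inJ _ _ (by constructor)
  | qJ x => cases x <;> exact .qJ _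
  | _ => constructor <;> assumption

/-- The triangle `w`, `u`, `v` turns one step backwards. The arcs from `w` to `y₁`, from `v` to `y₂`
and from `u` to `y₂'` are then permuted cyclically, in step with the cycle of the three copies. -/
theorem foldU_adj {f : V₁ → V₂} {g : V₂ → V₁} (hf : ∀ x y, G₁.Adj x y → G₂.Adj (f x) (f y))
    (hg : ∀ x y, G₂.Adj x y → G₁.Adj (g x) (g y)) (x y : GadgetVertex V₁ V₂)
    (h : (gadget G₁ G₂).Adj x y) : (gadget G₁ G₂).Adj (foldU f g x) (foldU f g y) := by
  change GadgetArc G₁ G₂ x y at h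
  change GadgetArc G₁ G₂ _ _
  cases h with
  | inJ x y h =>
    change JArc x y at h
    cases h <;> exact .inJ _ _ (by constructor)
  | qJ x => cases x <;> exact .qJ _
  | inG₁ a b h => exact .inG₂ _ _ (hf _ _ h)
  | inG₂ a b h => exact .inG₂' _ _ h
  | inG₂' a b h => exact .inG₁ _ _ (hg _ _ h)
  | _ => constructor

theorem gadget_homFull (hG₁ : G₁.IsOrientedClique) (hG₂ : G₂.IsOrientedClique)
    (h : G₁.Isomorphic G₂) : (gadget G₁ G₂).HomFull := by
  obtain ⟨e⟩ := h
  rw [homFull_iff]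
  intro W H φ hφ
  have hm : ∀ x y, φ x = φ y → Mergeable x y := fun x y =>
    mergeable_of_map_eq hG₁ hG₂ hφ.map_arc
  by_cases hu : φ (j .u) = φ (j .u')
  · by_cases hv : φ (j .v) = φ (j .v')
    · refine ⟨foldUV, foldUV_adj, fun x y => ⟨fun hxy => ?_, fun hxy => ?_⟩⟩
      · rcases x with (_ | _ | _ | _ | _) | _ | a | a | a <;>
          rcases y with (_ | _ | _ | _ | _) | _ | b | b | b <;>
          simp_all [foldUV]
      · cases hm x y hxy <;> rfl
    -- This is the only one of the four kernels for which the isomorphism is used.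
    · refine ⟨foldU e e.symm, foldU_adj (fun x y => e.map_rel_iff.2)
        (fun x y => e.symm.map_rel_iff.2), fun x y => ⟨fun hxy => ?_, fun hxy => ?_⟩⟩
      · rcases x with (_ | _ | _ | _ | _) | _ | a | a | a <;>
          rcases y with (_ | _ | _ | _ | _) | _ | b | b | b <;>
          simp_all [foldU]
      · cases hm x y hxy with
        | vv' => exact absurd hxy hv
        | v'v => exact absurd hxy.symm hv
        | _ => rfl
  · by_cases hv : φ (j .v) = φ (j .v')
    · refine ⟨foldV, foldV_adj, fun x y => ⟨fun hxy => ?_, fun hxy => ?_⟩⟩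
      · rcases x with (_ | _ | _ | _ | _) | _ | a | a | a <;>
          rcases y with (_ | _ | _ | _ | _) | _ | b | b | b <;>
          simp_all [foldV]
      · cases hm x y hxy with
        | uu' => exact absurd hxy hu
        | u'u => exact absurd hxy.symm hu
        | _ => rfl
    · refine ⟨id, fun x y h => h, fun x y => ⟨fun hxy => congrArg φ hxy, fun hxy => ?_⟩⟩
      cases hm x y hxy with
      | rfl => rfl
      | uu' => exact absurd hxy hu
      | u'u => exact absurd hxy.symm hu
      | vv' => exact absurd hxy hv
      | v'v => exact absurd hxy.symm hv

end Gadget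
end OrientedGraph

/-! ### A homomorphically full gadget makes the two graphs isomorphic. -/

namespace OrientedGraph
section Gadget

variable {V₁ V₂ : Type} {G₁ : OrientedGraph V₁} {G₂ : OrientedGraph V₂}

open GadgetVertex

/-- The identification of `u'` with `u`. -/
def mergeU : GadgetVertex V₁ V₂ → {x : GadgetVertex V₁ V₂ // x ≠ j .u'}
  | j .u' => ⟨j .u, by simp⟩
  | j .u => ⟨j .u, by simp⟩
  | j .v => ⟨j .v, by simp⟩
  | j .v' => ⟨j .v', by simp⟩
  | j .w => ⟨j .w, by simp⟩
  | q => ⟨q, by simp⟩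
  | y₁ a => ⟨y₁ a, by simp⟩
  | y₂ a => ⟨y₂ a, by simp⟩
  | y₂' a => ⟨y₂' a, by simp⟩

theorem mergeU_eq_iff {x y : GadgetVertex V₁ V₂} : mergeU x = mergeU y ↔
    x = y ∨ (x = j .u ∧ y = j .u') ∨ (x = j .u' ∧ y = j .u) := by
  rcases x with (_ | _ | _ | _ | _) | _ | a | a | a <;>
    rcases y with (_ | _ | _ | _ | _) | _ | b | b | b <;> simp [mergeU]

theorem mergeU_surjective : Function.Surjective (mergeU (V₁ := V₁) (V₂ := V₂)) := by
  rintro ⟨x, hx⟩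
  refine ⟨x, ?_⟩
  rcases x with (_ | _ | _ | _ | _) | _ | a | a | a <;> first | rfl | exact absurd rfl hx

theorem not_adj_u'_u (x : GadgetVertex V₁ V₂) (h : GadgetArc G₁ G₂ (j .u') x)
    (h' : GadgetArc G₁ G₂ x (j .u)) : False := by
  cases h with
  | inJ _ y h =>
    change JArc _ _ at h
    cases h <;>
    · cases h' with
      | inJ _ _ h => change JArc _ _ at h; cases h

theorem not_adj_u_u' (x : GadgetVertex V₁ V₂) (h : GadgetArc G₁ G₂ (j .u) x)
    (h' : GadgetArc G₁ G₂ x (j .u')) : False := by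
  cases h with
  | inJ _ y h =>
    change JArc _ _ at h
    cases h
    cases h' with
    | inJ _ _ h => change JArc _ _ at h; cases h
  | uy₂' a => cases h'

theorem not_adj_both (x y : GadgetVertex V₁ V₂) (hx : x = j .u ∨ x = j .u')
    (hy : y = j .u ∨ y = j .u') : ¬ GadgetArc G₁ G₂ x y := by
  intro h
  rcases hx with rfl | rfl <;> rcases hy with rfl | rfl <;>
  · cases h with
    | inJ _ _ h => change JArc _ _ at h; cases h

/-- A 2-cycle in the quotient would need an arc or a directed path of length 2 between `u` and `u'`.
There is none, so the quotient is an oriented graph. -/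
theorem mergeU_no_two_cycle (x y x' y' : GadgetVertex V₁ V₂) (h : (gadget G₁ G₂).Adj x y)
    (h' : (gadget G₁ G₂).Adj x' y') (h1 : mergeU x = mergeU y') (h2 : mergeU y = mergeU x') :
    False := by
  have hb := not_adj_both (G₁ := G₁) (G₂ := G₂)
  rw [mergeU_eq_iff] at h1 h2
  rcases h1 with rfl | ⟨rfl, rfl⟩ | ⟨rfl, rfl⟩
  · rcases h2 with rfl | ⟨rfl, rfl⟩ | ⟨rfl, rfl⟩
    · exact (gadget G₁ G₂).asymm _ _ h h'
    · exact not_adj_u'_u _ h' h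
    · exact not_adj_u_u' _ h' h
  · rcases h2 with rfl | ⟨rfl, rfl⟩ | ⟨rfl, rfl⟩
    · exact not_adj_u_u' _ h h'
    · exact hb _ _ (.inl rfl) (.inl rfl) h
    · exact hb _ _ (.inl rfl) (.inr rfl) h
  · rcases h2 with rfl | ⟨rfl, rfl⟩ | ⟨rfl, rfl⟩
    · exact not_adj_u'_u _ h h'
    · exact hb _ _ (.inr rfl) (.inl rfl) h
    · exact hb _ _ (.inr rfl) (.inr rfl) h

instance : Finite JVertex :=
  Finite.of_surjective (fun i : Fin 5 => ![JVertex.u, .u', .v, .v', .w] i) fun x => by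
    cases x
    exacts [⟨0, rfl⟩, ⟨1, rfl⟩, ⟨2, rfl⟩, ⟨3, rfl⟩, ⟨4, rfl⟩]

instance [Finite V₁] [Finite V₂] : Finite (GadgetVertex V₁ V₂) :=
  Finite.of_surjective
    (fun x : (JVertex ⊕ Unit) ⊕ (V₁ ⊕ (V₂ ⊕ V₂)) => match x with
      | .inl (.inl x) => j x
      | .inl (.inr _) => q
      | .inr (.inl x) => y₁ x
      | .inr (.inr (.inl x)) => y₂ x
      | .inr (.inr (.inr x)) => y₂' x) fun x => by
    cases x with
    | j x => exact ⟨.inl (.inl x), rfl⟩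
    | q => exact ⟨.inl (.inr ()), rfl⟩
    | y₁ x => exact ⟨.inr (.inl x), rfl⟩
    | y₂ x => exact ⟨.inr (.inr (.inl x)), rfl⟩
    | y₂' x => exact ⟨.inr (.inr (.inr x)), rfl⟩

/-- A self-map of a finite type that is injective off one point misses at most one point. -/
theorem eq_of_notMem_range {α : Type*} [Finite α] {r : α → α} {z : α}
    (hr : ∀ x y, x ≠ z → y ≠ z → r x = r y → x = y) {a b : α} (ha : ∀ x, r x ≠ a)
    (hb : ∀ x, r x ≠ b) : a = b := by
  classical
  by_contra hab
  -- Redirecting the exceptional point to the missed value `a` makes the map injective, hence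
  -- surjective; but `b` is still missed.
  let s : α → α := fun x => if x = z then a else r x
  have hs : Function.Injective s := by
    intro x y h
    by_cases hx : x = z <;> by_cases hy : y = z
    · rw [hx, hy]
    · simp only [s, hx, hy, if_true, if_false] at h
      exact absurd h.symm (ha y)
    · simp only [s, hx, hy, if_true, if_false] at h
      exact absurd h (ha x)
    · simp only [s, hx, hy, if_false] at h
      exact hr x y hx hy h
  obtain ⟨x, hx⟩ := Finite.injective_iff_surjective.1 hs b
  by_cases h : x = z
  · simp only [s, h, if_true] at hx
    exact hab hx
  · simp only [s, h, if_false] at hx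
    exact hb x hx

/-- Every vertex of the gadget other than `q` has two non-neighbours. -/
theorem exists_two_nonadj (a₂ : V₂) (p : GadgetVertex V₁ V₂) (hp : p ≠ q) :
    ∃ c d, c ≠ d ∧ c ≠ p ∧ d ≠ p ∧ ¬ (gadget G₁ G₂).Adj p c ∧ ¬ (gadget G₁ G₂).Adj c p ∧
      ¬ (gadget G₁ G₂).Adj p d ∧ ¬ (gadget G₁ G₂).Adj d p := by
  have key : ∃ c d, c ≠ d ∧ c ≠ p ∧ d ≠ p ∧ ¬ GadgetArc G₁ G₂ p c ∧ ¬ GadgetArc G₁ G₂ c p ∧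
      ¬ GadgetArc G₁ G₂ p d ∧ ¬ GadgetArc G₁ G₂ d p := by
    rcases p with (_ | _ | _ | _ | _) | _ | a | a | a
    · exact ⟨j .u', y₂ a₂, by simp, by simp, by simp, not_adj_both _ _ (by simp) (by simp),
        not_adj_both _ _ (by simp) (by simp), nofun, nofun⟩
    · exact ⟨y₂' a₂, y₂ a₂, by simp, by simp, by simp, nofun, nofun, nofun, nofun⟩
    · refine ⟨j .v', y₂' a₂, by simp, by simp, by simp, ?_, ?_, nofun, nofun⟩ <;>
      · intro h
        cases h with
        | inJ _ _ h => change JArc _ _ at h; cases h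
    · exact ⟨y₂ a₂, y₂' a₂, by simp, by simp, by simp, nofun, nofun, nofun, nofun⟩
    · exact ⟨y₂ a₂, y₂' a₂, by simp, by simp, by simp, nofun, nofun, nofun, nofun⟩
    · exact absurd rfl hp
    · exact ⟨j .u', j .v', by simp, by simp, by simp, nofun, nofun, nofun, nofun⟩
    · exact ⟨j .u', j .v', by simp, by simp, by simp, nofun, nofun, nofun, nofun⟩
    · exact ⟨j .u', j .v', by simp, by simp, by simp, nofun, nofun, nofun, nofun⟩
  exact key

theorem isomorphic_of_gadget_homFull [Finite V₁] [Finite V₂] [Nonempty V₁] [Nonempty V₂]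
    (h : (gadget G₁ G₂).HomFull) : G₁.Isomorphic G₂ := by
  rw [homFull_iff] at h
  obtain ⟨r, hr', hk⟩ := h _ _ mergeU
    (isCompleteHom_image (gadget G₁ G₂) mergeU mergeU_no_two_cycle mergeU_surjective)
  have hr : ∀ x y, GadgetArc G₁ G₂ x y → GadgetArc G₁ G₂ (r x) (r y) := hr'
  simp only [mergeU_eq_iff] at hk
  obtain ⟨a₁⟩ := ‹Nonempty V₁›
  obtain ⟨a₂⟩ := ‹Nonempty V₂›
  have hinj : ∀ x y : GadgetVertex V₁ V₂, x ≠ j .u' → y ≠ j .u' → r x = r y → x = y := by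
    intro x y hx hy hxy
    rcases (hk x y).1 hxy with h | h | h
    · exact h
    · exact absurd h.2 hy
    · exact absurd h.1 hx
  -- Since `q` is adjacent to all other vertices, a non-neighbour of `r q` other than `r q` lies
  -- outside the range of `r`. At most one vertex does, whereas each vertex except `q` has two
  -- non-neighbours.
  have hq : r q = q := by
    by_contra hne
    obtain ⟨c, d, hcd, hc, hd, h1, h2, h3, h4⟩ :=
      exists_two_nonadj (G₁ := G₁) (G₂ := G₂) a₂ _ hne
    have hadj : ∀ x : GadgetVertex V₁ V₂, x = q ∨ GadgetArc G₁ G₂ q x ∨ GadgetArc G₁ G₂ x q := by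
      rintro (x | _ | x | x | x)
      · exact .inr (.inl (.qJ _))
      · exact .inl rfl
      · exact .inr (.inr (.y₁q _))
      · exact .inr (.inr (.y₂q _))
      · exact .inr (.inr (.y₂'q _))
    have hmiss : ∀ c, c ≠ r q → ¬ (gadget G₁ G₂).Adj (r q) c → ¬ (gadget G₁ G₂).Adj c (r q) →
        ∀ x, r x ≠ c := by
      rintro c hc h1 h2 x rfl
      rcases hadj x with rfl | h | h
      · exact hc rfl
      · exact h1 (hr' _ _ h)
      · exact h2 (hr' _ _ h)
    exact hcd (eq_of_notMem_range hinj (hmiss c hc h1 h2) (hmiss d hd h3 h4))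
  -- The out-neighbours of `q` are exactly the vertices of `J`.
  have hJ : ∀ x, ∃ x', r (j x) = j x' := by
    intro x
    have := hr _ _ (.qJ x)
    rw [hq] at this
    generalize r (j x) = z at this
    cases this
    exact ⟨_, rfl⟩
  obtain ⟨u₀, hu⟩ := hJ .u
  obtain ⟨v₀, hv⟩ := hJ .v
  obtain ⟨v₁, hv'⟩ := hJ .v'
  obtain ⟨w₀, hw⟩ := hJ .w
  have huu' : r (j .u') = r (j .u) := (hk _ _).2 (.inr (.inr ⟨rfl, rfl⟩))
  have hne : v₀ ≠ v₁ := by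
    rintro rfl
    have := hinj (j .v) (j .v') (by simp) (by simp) (hv.trans hv'.symm)
    simp at this
  have key : ∀ {x y x' y'}, JArc x y → r (j x) = j x' → r (j y) = j y' → JArc x' y' := by
    intro x y x' y' h hx hy
    have := hr _ _ (.inJ _ _ h)
    rw [hx, hy] at this
    cases this with
    | inJ _ _ h => exact h
  have k1 := key .uv hu hv
  have k2 := key .u'v' (huu'.trans hu) hv'
  have k3 := key .vw hv hw
  have k4 := key .v'w hv' hw
  have k5 := key .wu hw hu
  have hy₁ : ∀ a, GadgetArc G₁ G₂ (j w₀) (r (y₁ a)) ∧ GadgetArc G₁ G₂ (r (y₁ a)) q := fun a => by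
    have h1 := hr _ _ (.wy₁ a)
    have h2 := hr _ _ (.y₁q a)
    rw [hw] at h1
    rw [hq] at h2
    exact ⟨h1, h2⟩
  have hy₂ : ∀ a, GadgetArc G₁ G₂ (j v₀) (r (y₂ a)) ∧ GadgetArc G₁ G₂ (r (y₂ a)) q := fun a => by
    have h1 := hr _ _ (.vy₂ a)
    have h2 := hr _ _ (.y₂q a)
    rw [hv] at h1
    rw [hq] at h2
    exact ⟨h1, h2⟩
  have hy₂' : ∀ a, GadgetArc G₁ G₂ (j u₀) (r (y₂' a)) ∧ GadgetArc G₁ G₂ (r (y₂' a)) q :=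
    fun a => by
    have h1 := hr _ _ (.uy₂' a)
    have h2 := hr _ _ (.y₂'q a)
    rw [hu] at h1
    rw [hq] at h2
    exact ⟨h1, h2⟩
  -- The images of the copies have arcs to `q`, hence lie in the copies again; `u'` has no arc into
  -- a copy.
  have hu' : u₀ ≠ .u' := by
    rintro rfl
    obtain ⟨h1, h2⟩ := hy₂' a₂
    generalize r (y₂' a₂) = z at h1 h2
    cases h1
    cases h2
  have hvu' : v₀ ≠ .u' := by
    rintro rfl
    obtain ⟨h1, h2⟩ := hy₂ a₂
    generalize r (y₂ a₂) = z at h1 h2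
    cases h1
    cases h2
  -- The image of `u` has two distinct out-neighbours in `J`, the images of `v` and `v'`, because
  -- `u'` has the same image. This leaves `u'` and `w`, and `u'` is excluded; `hvu'` then decides
  -- which of `u` and `u'` is the image of `v`.
  obtain ⟨rfl, rfl, rfl⟩ : u₀ = .w ∧ v₀ = .u ∧ w₀ = .v := by
    cases k1 <;> cases k2 <;> cases k3 <;> cases k4 <;> simp_all
  -- Among the out-neighbours of `v`, those with an arc to `q` form the first copy of `G₂`. In the
  -- same way `w` singles out `G₁` for `h₂`.
  have h₁ : ∀ a, ∃ b, r (y₁ a) = y₂ b := fun a => by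
    obtain ⟨h1, h2⟩ := hy₁ a
    generalize r (y₁ a) = z at h1 h2
    cases h1
    · cases h2
    · exact ⟨_, rfl⟩
  have h₂ : ∀ a, ∃ b, r (y₂' a) = y₁ b := fun a => by
    obtain ⟨h1, h2⟩ := hy₂' a
    generalize r (y₂' a) = z at h1 h2
    cases h1
    · cases h2
    · exact ⟨_, rfl⟩
  choose f hf using h₁
  choose g hg using h₂
  refine isomorphic_of_injective (f := f) (g := g) ?_ ?_ ?_ ?_
  · intro x y hxy
    have := hinj (y₁ x) (y₁ y) (by simp) (by simp) (by rw [hf, hf, hxy])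
    simpa using this
  · intro x y hxy
    have := hinj (y₂' x) (y₂' y) (by simp) (by simp) (by rw [hg, hg, hxy])
    simpa using this
  · intro x y hxy
    have := hr _ _ (.inG₁ _ _ hxy)
    rw [hf, hf] at this
    cases this
    assumption
  · intro x y hxy
    have := hr _ _ (.inG₂' _ _ hxy)
    rw [hg, hg] at this
    cases this
    assumption

theorem isomorphic_iff_gadget_homFull [Finite V₁] [Finite V₂] [Nonempty V₁] [Nonempty V₂]
    (hG₁ : G₁.IsOrientedClique) (hG₂ : G₂.IsOrientedClique) :
    G₁.Isomorphic G₂ ↔ (gadget G₁ G₂).HomFull :=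
  ⟨gadget_homFull hG₁ hG₂, isomorphic_of_gadget_homFull⟩

end Gadget
end OrientedGraph

/-! ### From simple graphs to oriented cliques -/

/-- The vertices of the oriented clique of a simple graph on `V`. -/
inductive CliqueVertex (V : Type*)
  | s
  | t
  | a (x : V)
  | b (x : V)
  | c (x : V)

/-- The arcs of the oriented clique of a simple graph. -/
inductive CliqueArc {V : Type*} (G : SimpleGraph V) : CliqueVertex V → CliqueVertex V → Prop
  | st : CliqueArc G .s .t
  | sc (x : V) : CliqueArc G .s (.c x)
  | ta (x : V) : CliqueArc G (.a x) .t
  | ca (x : V) : CliqueArc G (.c x) (.a x)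
  | cb (x : V) : CliqueArc G (.c x) (.b x)
  | ac (x y : V) : x ≠ y → CliqueArc G (.a x) (.c y)
  | bc (x y : V) : x ≠ y → CliqueArc G (.b x) (.c y)
  | ab (x y : V) : G.Adj x y → CliqueArc G (.a x) (.b y)
  | ba (x y : V) : ¬ G.Adj x y → CliqueArc G (.b x) (.a y)

/-- An oriented clique that determines the simple graph `G` up to isomorphism. -/
def cliqueGraph {V : Type*} (G : SimpleGraph V) : OrientedGraph (CliqueVertex V) where
  Adj := CliqueArc G
  asymm := by
    intro x y h h'
    cases h with
    | ca x => cases h' with | ac _ _ h => exact h rfl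
    | cb x => cases h' with | bc _ _ h => exact h rfl
    | ac x y h => cases h'; exact h rfl
    | bc x y h => cases h'; exact h rfl
    | ab x y h => cases h' with | ba _ _ k => exact k h.symm
    | ba x y h => cases h' with | ab _ _ k => exact h k.symm
    | _ => cases h'

namespace OrientedGraph

section Clique

variable {V W : Type*} {G : SimpleGraph V} {H : SimpleGraph W}

open CliqueVertex

/-- Two vertices `a`, or two vertices `b`, are joined through a `c`, and two vertices `c` through an
`a`. Paths from `s` go through a `c`, and paths to `t` through an `a`; irreflexivity of `G` provides
the arc from `b x` to `a x`. -/
theorem cliqueGraph_isOrientedClique : (cliqueGraph G).IsOrientedClique := by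
  have key : ∀ x y : CliqueVertex V, x = y ∨ CliqueArc G x y ∨ CliqueArc G y x ∨
      ∃ z, (CliqueArc G x z ∧ CliqueArc G z y) ∨ (CliqueArc G y z ∧ CliqueArc G z x) := by
    rintro (_ | _ | x | x | x) (_ | _ | y | y | y)
    · exact .inl rfl
    · exact .inr (.inl .st)
    · exact .inr (.inr (.inr ⟨c y, .inl ⟨.sc _, .ca _⟩⟩))
    · exact .inr (.inr (.inr ⟨c y, .inl ⟨.sc _, .cb _⟩⟩))
    · exact .inr (.inl (.sc _))
    · exact .inr (.inr (.inl .st))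
    · exact .inl rfl
    · exact .inr (.inr (.inl (.ta _)))
    · exact .inr (.inr (.inr ⟨a y, .inr ⟨.ba _ _ G.irrefl, .ta _⟩⟩))
    · exact .inr (.inr (.inr ⟨a y, .inr ⟨.ca _, .ta _⟩⟩))
    · exact .inr (.inr (.inr ⟨c x, .inr ⟨.sc _, .ca _⟩⟩))
    · exact .inr (.inl (.ta _))
    · by_cases h : x = y
      · exact .inl (h ▸ rfl)
      · exact .inr (.inr (.inr ⟨c y, .inl ⟨.ac _ _ h, .ca _⟩⟩))
    · by_cases h : G.Adj x y
      · exact .inr (.inl (.ab _ _ h))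
      · exact .inr (.inr (.inl (.ba _ _ fun h' => h h'.symm)))
    · by_cases h : x = y
      · exact .inr (.inr (.inl (h ▸ .ca _)))
      · exact .inr (.inl (.ac _ _ h))
    · exact .inr (.inr (.inr ⟨c x, .inr ⟨.sc _, .cb _⟩⟩))
    · exact .inr (.inr (.inr ⟨a x, .inl ⟨.ba _ _ G.irrefl, .ta _⟩⟩))
    · by_cases h : G.Adj y x
      · exact .inr (.inr (.inl (.ab _ _ h)))
      · exact .inr (.inl (.ba _ _ fun h' => h h'.symm))
    · by_cases h : x = y
      · exact .inl (h ▸ rfl)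
      · exact .inr (.inr (.inr ⟨c y, .inl ⟨.bc _ _ h, .cb _⟩⟩))
    · by_cases h : x = y
      · exact .inr (.inr (.inl (h ▸ .cb _)))
      · exact .inr (.inl (.bc _ _ h))
    · exact .inr (.inr (.inl (.sc _)))
    · exact .inr (.inr (.inr ⟨a x, .inl ⟨.ca _, .ta _⟩⟩))
    · by_cases h : x = y
      · exact .inr (.inl (h ▸ .ca _))
      · exact .inr (.inr (.inl (.ac _ _ (Ne.symm h))))
    · by_cases h : x = y
      · exact .inr (.inl (h ▸ .cb _))
      · exact .inr (.inr (.inl (.bc _ _ (Ne.symm h))))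
    · by_cases h : x = y
      · exact .inl (h ▸ rfl)
      · exact .inr (.inr (.inr ⟨a x, .inl ⟨.ca _, .ac _ _ h⟩⟩))
  intro x y h h1 h2
  rcases key x y with h3 | h3 | h3 | h3
  · exact absurd h3 h
  · exact absurd h3 h1
  · exact absurd h3 h2
  · exact h3

/-- The map on clique vertices induced by a map of the underlying vertices. -/
def CliqueVertex.map (f : V → W) : CliqueVertex V → CliqueVertex W
  | s => s
  | t => t
  | a x => a (f x)
  | b x => b (f x)
  | c x => c (f x)

theorem cliqueGraph_adj_map (e : G ≃g H) (x y : CliqueVertex V)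
    (h : (cliqueGraph G).Adj x y) :
    (cliqueGraph H).Adj (CliqueVertex.map e x) (CliqueVertex.map e y) := by
  change CliqueArc G x y at h
  change CliqueArc H _ _
  cases h with
  | ab x y h => exact .ab _ _ (e.map_rel_iff.2 h)
  | ba x y h => exact .ba _ _ (fun k => h (e.map_rel_iff.1 k))
  | ac x y h => exact .ac _ _ (e.injective.ne h)
  | bc x y h => exact .bc _ _ (e.injective.ne h)
  | _ => constructor

theorem CliqueVertex.map_injective {f : V → W} (hf : Function.Injective f) :
    Function.Injective (CliqueVertex.map f) := by
  rintro (_ | _ | x | x | x) (_ | _ | y | y | y) h <;> simp_all [CliqueVertex.map, hf.eq_iff]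

/-- This and the analogous statement for sinks let isomorphisms recognise `s` and `t`. -/
theorem eq_s_of_source {z : CliqueVertex V} (h : ∀ y, ¬ CliqueArc G y z) : z = s := by
  rcases z with _ | _ | x | x | x
  · rfl
  · exact absurd .st (h _)
  · exact absurd (.ca x) (h _)
  · exact absurd (.cb x) (h _)
  · exact absurd (.sc x) (h _)

theorem eq_t_of_sink {z : CliqueVertex V} (h : ∀ y, ¬ CliqueArc G z y) : z = t := by
  rcases z with _ | _ | x | x | x
  · exact absurd .st (h _)
  · rfl
  · exact absurd (.ta x) (h _)
  · exact absurd (.ba x x G.irrefl) (h _)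
  · exact absurd (.ca x) (h _)

theorem finite_cliqueVertex [Finite V] : Finite (CliqueVertex V) :=
  Finite.of_surjective
    (fun x : Bool ⊕ (V ⊕ (V ⊕ V)) => match x with
      | .inl false => s
      | .inl true => t
      | .inr (.inl x) => a x
      | .inr (.inr (.inl x)) => b x
      | .inr (.inr (.inr x)) => c x) fun x => by
    cases x with
    | s => exact ⟨.inl false, rfl⟩
    | t => exact ⟨.inl true, rfl⟩
    | a x => exact ⟨.inr (.inl x), rfl⟩
    | b x => exact ⟨.inr (.inr (.inl x)), rfl⟩
    | c x => exact ⟨.inr (.inr (.inr x)), rfl⟩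

/-- An isomorphism of the cliques maps the vertices of each kind alike. -/
theorem exists_map_of_iso (e : (cliqueGraph G).Adj ≃r (cliqueGraph H).Adj) :
    ∃ f : V → W, (∀ x, e (a x) = a (f x)) ∧ (∀ x, e (b x) = b (f x)) ∧
      ∀ x, e (c x) = c (f x) := by
  have he : ∀ {x y}, CliqueArc G x y → CliqueArc H (e x) (e y) := fun h => e.map_rel_iff.2 h
  have he' : ∀ {x y}, CliqueArc H (e x) (e y) → CliqueArc G x y := fun h => e.map_rel_iff.1 h
  have hs : e s = s := eq_s_of_source (G := H) fun y h => by
    rw [← e.apply_symm_apply y] at h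
    have h' := he' h
    generalize e.symm y = z at h'
    cases h'
  have ht : e t = t := eq_t_of_sink (G := H) fun y h => by
    rw [← e.apply_symm_apply y] at h
    have h' := he' h
    generalize e.symm y = z at h'
    cases h'
  -- Apart from `t`, the out-neighbours of `s` are the vertices `c`; apart from `s`, the
  -- in-neighbours of `t` are the vertices `a`.
  have hc : ∀ x, ∃ y, e (c x) = c y := fun x => by
    have h := he (.sc x)
    rw [hs] at h
    generalize hz : e (c x) = z at h
    cases h with
    | st =>
      rw [← ht] at hz
      simpa using e.injective hz
    | sc y => exact ⟨y, rfl⟩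
  have ha : ∀ x, ∃ y, e (a x) = a y := fun x => by
    have h := he (.ta x)
    rw [ht] at h
    generalize hz : e (a x) = z at h
    cases h with
    | st =>
      rw [← hs] at hz
      simpa using e.injective hz
    | ta y => exact ⟨y, rfl⟩
  choose f hf using hc
  -- The only out-neighbours of `c x` are `a x` and `b x`, so the index of `c` determines those of
  -- `a` and `b`.
  have hfa : ∀ x, e (a x) = a (f x) := fun x => by
    obtain ⟨y, hy⟩ := ha x
    have h := he (.ca x)
    rw [hf, hy] at h
    cases h
    exact hy
  have hfb : ∀ x, e (b x) = b (f x) := fun x => by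
    have h := he (.cb x)
    rw [hf] at h
    generalize hz : e (b x) = z at h
    cases h with
    | ca =>
      rw [← hfa] at hz
      simpa using e.injective hz
    | cb => rfl
  exact ⟨f, hfa, hfb, hf⟩

/-- An isomorphism acts on the indices by a bijection, and the arcs from `a x` to `b y` show that
this bijection preserves and reflects adjacency. -/
theorem cliqueGraph_isomorphic_iff [Finite V] [Finite W] :
    (cliqueGraph G).Isomorphic (cliqueGraph H) ↔ Nonempty (G ≃g H) := by
  constructor
  · rintro ⟨e⟩
    obtain ⟨f, hfa, hfb, -⟩ := exists_map_of_iso e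
    obtain ⟨g, hga, -, -⟩ := exists_map_of_iso e.symm
    have h1 : ∀ x, g (f x) = x := fun x => by
      have := e.symm_apply_apply (a x)
      rw [hfa, hga] at this
      simpa using this
    have h2 : ∀ x, f (g x) = x := fun x => by
      have := e.apply_symm_apply (a x)
      rw [hga, hfa] at this
      simpa using this
    refine ⟨⟨⟨f, g, h1, h2⟩, fun {x y} => ?_⟩⟩
    have key : CliqueArc H (e (a x)) (e (b y)) ↔ CliqueArc G (a x) (b y) := e.map_rel_iff
    rw [hfa, hfb] at key
    constructor
    · intro h
      cases key.1 (.ab _ _ h)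
      assumption
    · intro h
      cases key.2 (.ab _ _ h)
      assumption
  · rintro ⟨e⟩
    have := finite_cliqueVertex (V := V)
    have := finite_cliqueVertex (V := W)
    exact isomorphic_of_injective (CliqueVertex.map_injective e.injective)
      (CliqueVertex.map_injective e.symm.injective) (cliqueGraph_adj_map e)
      (cliqueGraph_adj_map e.symm)

end Clique

end OrientedGraph

/-! ### A structured language for stack machines -/

open Turing

/-- Programs for machines with stacks indexed by `K`. The program `loop k ends body` repeatedly
pops the stack `k`; it ends if the stack was empty or if the popped symbol `a` satisfies `ends a`,
and runs `body a` before the next round otherwise. -/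
inductive StackProg {K : Type} (Γ : K → Type) : Type
  | skip
  | push (k : K) (x : Γ k)
  | seq (p₁ p₂ : StackProg Γ)
  | loop (k : K) (ends : Γ k → Bool) (body : Γ k → StackProg Γ)

namespace StackProg

variable {K : Type} {Γ : K → Type}

section Semantics

variable [DecidableEq K]

/-- `Runs p S S' t`: started with stacks `S`, the program `p` ends with stacks `S'` within `t`
steps. -/
inductive Runs : StackProg Γ → (∀ k, List (Γ k)) → (∀ k, List (Γ k)) → ℕ → Prop
  | skip (S) : Runs .skip S S 1
  | push (k x S) : Runs (.push k x) S (Function.update S k (x :: S k)) 1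
  | seq {p₁ p₂ S₁ S₂ S₃ t₁ t₂} : Runs p₁ S₁ S₂ t₁ → Runs p₂ S₂ S₃ t₂ →
      Runs (.seq p₁ p₂) S₁ S₃ (t₁ + t₂)
  | loop_nil {k ends body S} : S k = [] → Runs (.loop k ends body) S S 1
  | loop_end {k ends body S x l} : S k = x :: l → ends x = true →
      Runs (.loop k ends body) S (Function.update S k l) 1
  | loop_cons {k ends body S x l S₁ S₂ t₁ t₂} : S k = x :: l → ends x = false →
      Runs (body x) (Function.update S k l) S₁ t₁ → Runs (.loop k ends body) S₁ S₂ t₂ →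
      Runs (.loop k ends body) S S₂ (t₁ + t₂ + 1)
  | mono {p S S' t t'} : Runs p S S' t → t ≤ t' → Runs p S S' t'

end Semantics

/-- The labels of the machine that runs a program. -/
def Label : StackProg Γ → Type
  | skip => Unit
  | push _ _ => Unit
  | seq p₁ p₂ => Label p₁ ⊕ Label p₂
  | loop k _ body => Unit ⊕ Σ x : Γ k, Label (body x)

/-- The label at which the machine starts. -/
def entry : (p : StackProg Γ) → Label p
  | skip => ()
  | push _ _ => ()
  | seq p₁ _ => .inl (entry p₁)
  | loop _ _ _ => .inl ()

noncomputable instance labelFintype [∀ k, Fintype (Γ k)] : (p : StackProg Γ) → Fintype (Label p)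
  | skip => inferInstanceAs (Fintype Unit)
  | push _ _ => inferInstanceAs (Fintype Unit)
  | seq p₁ p₂ =>
    letI := labelFintype p₁
    letI := labelFintype p₂
    inferInstanceAs (Fintype (Label p₁ ⊕ Label p₂))
  | loop k _ body =>
    letI := fun x => labelFintype (body x)
    inferInstanceAs (Fintype (Unit ⊕ Σ x : Γ k, Label (body x)))

section Compile

variable [DecidableEq K]

/-- The statements of the machine that runs a program and then continues at the label `exit`. The
register remembers the symbol last popped from each stack. -/
def code {Λ : Type} : (p : StackProg Γ) → (Label p → Λ) → Λ → Label p →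
    TM2.Stmt Γ Λ (∀ k, Option (Γ k))
  | skip, _, exit, _ => .goto fun _ => exit
  | push k x, _, exit, _ => .push k (fun _ => x) (.goto fun _ => exit)
  | seq p₁ p₂, emb, exit, l => match l with
    | .inl l => code p₁ (emb ∘ .inl) (emb (.inr (entry p₂))) l
    | .inr l => code p₂ (emb ∘ .inr) exit l
  | loop k ends body, emb, exit, l => match l with
    | .inl _ => .pop k (fun v o => Function.update v k o) (.goto fun v => match v k with
      | none => exit
      | some x => if ends x then exit else emb (.inr ⟨x, entry (body x)⟩))
    | .inr ⟨x, l⟩ => code (body x) (fun l => emb (.inr ⟨x, l⟩)) (emb (.inl ())) l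

theorem code_entry_loop {Λ : Type} (k : K) (ends : Γ k → Bool) (body : Γ k → StackProg Γ)
    (emb : Label (.loop k ends body) → Λ) (exit : Λ) :
    code (.loop k ends body) emb exit (entry (.loop k ends body)) =
      .pop k (fun v o => Function.update v k o) (.goto fun v => match v k with
        | none => exit
        | some x => if ends x then exit else emb (Sum.inr ⟨x, entry (body x)⟩)) := rfl

/-- `Steps M a b t`: the machine `M` gets from `a` to `b` in at most `t` steps. -/
def Steps {Λ σ : Type} (M : Λ → TM2.Stmt Γ Λ σ) (a b : TM2.Cfg Γ Λ σ) (t : ℕ) : Prop :=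
  Nonempty (StateTransition.EvalsToInTime (TM2.step M) a (some b) t)

theorem Steps.trans {Λ σ : Type} {M : Λ → TM2.Stmt Γ Λ σ} {a b c : TM2.Cfg Γ Λ σ} {t t' : ℕ}
    (h : Steps M a b t) (h' : Steps M b c t') : Steps M a c (t + t') := by
  obtain ⟨h⟩ := h
  obtain ⟨h'⟩ := h'
  rw [add_comm]
  exact ⟨StateTransition.EvalsToInTime.trans _ _ _ _ _ _ h h'⟩

theorem Steps.mono {Λ σ : Type} {M : Λ → TM2.Stmt Γ Λ σ} {a b : TM2.Cfg Γ Λ σ} {t t' : ℕ}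
    (h : Steps M a b t) (ht : t ≤ t') : Steps M a b t' := by
  obtain ⟨h⟩ := h
  exact ⟨⟨h.toEvalsTo, h.steps_le_m.trans ht⟩⟩

theorem Steps.congr {Λ σ : Type} {M : Λ → TM2.Stmt Γ Λ σ} {a b a' b' : TM2.Cfg Γ Λ σ} {t : ℕ}
    (h : Steps M a b t) (ha : a' = a) (hb : b' = b) : Steps M a' b' t :=
  ha ▸ hb ▸ h

theorem Steps.single {Λ σ : Type} {M : Λ → TM2.Stmt Γ Λ σ} {a b : TM2.Cfg Γ Λ σ}
    (h : TM2.step M a = some b) : Steps M a b 1 :=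
  ⟨⟨⟨1, h⟩, le_rfl⟩⟩

/-- The machine and the embedding of labels are arbitrary, so that the induction hypothesis applies
to a subprogram inside a larger machine. The initial register is arbitrary too, since each pop
overwrites the entry that is tested next. -/
theorem Runs.steps {p : StackProg Γ} {S S' : ∀ k, List (Γ k)} {t : ℕ} (h : Runs p S S' t) :
    ∀ {Λ : Type} (M : Λ → TM2.Stmt Γ Λ (∀ k, Option (Γ k))) (emb : Label p → Λ) (exit : Λ),
      (∀ l, M (emb l) = code p emb exit l) → ∀ v, ∃ v',
        Steps M ⟨some (emb (entry p)), v, S⟩ ⟨some exit, v', S'⟩ t := by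
  induction h with
  | skip S =>
    intro Λ M emb exit hM v
    exact ⟨v, .single (by simp [hM, code])⟩
  | push k x S =>
    intro Λ M emb exit hM v
    exact ⟨v, .single (by simp [hM, code])⟩
  | @seq p₁ p₂ S₁ S₂ S₃ t₁ t₂ h₁ h₂ ih₁ ih₂ =>
    intro Λ M emb exit hM v
    obtain ⟨v₁, hv₁⟩ := ih₁ M (emb ∘ .inl) (emb (.inr (entry p₂)))
      (fun l => hM (Sum.inl l)) v
    obtain ⟨v₂, hv₂⟩ := ih₂ M (emb ∘ .inr) exit (fun l => hM (Sum.inr l)) v₁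
    exact ⟨v₂, hv₁.trans hv₂⟩
  | @loop_nil k ends body S hS =>
    intro Λ M emb exit hM v
    exact ⟨Function.update v k none, .single (by
      rw [TM2.step, hM, code_entry_loop]; simp [hS])⟩
  | @loop_end k ends body S x l hS hx =>
    intro Λ M emb exit hM v
    exact ⟨Function.update v k (some x), .single (by
      rw [TM2.step, hM, code_entry_loop]; simp [hS, hx])⟩
  | @loop_cons k ends body S x l S₁ S₂ t₁ t₂ hS hx h₁ h₂ ih₁ ih₂ =>
    intro Λ M emb exit hM v
    obtain ⟨v₁, hv₁⟩ := ih₁ M (fun l => emb (.inr ⟨x, l⟩)) (emb (.inl ()))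
      (fun l => hM (Sum.inr ⟨x, l⟩)) (Function.update v k (some x))
    obtain ⟨v₂, hv₂⟩ := ih₂ M emb exit hM v₁
    refine ⟨v₂, ((Steps.single ?_).trans (hv₁.trans hv₂)).mono (by omega)⟩
    rw [TM2.step, hM, code_entry_loop]
    simp [hS, hx]
  | mono _ ht ih =>
    intro Λ M emb exit hM v
    obtain ⟨v', hv'⟩ := ih M emb exit hM v
    exact ⟨v', hv'.mono ht⟩

/-- The machine that runs a program and halts. -/
noncomputable def toMachine [Fintype K] [∀ k, Fintype (Γ k)] (p : StackProg Γ) (k₀ k₁ : K) :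
    FinTM2 where
  K := K
  k₀ := k₀
  k₁ := k₁
  Γ := Γ
  Λ := Option (Label p)
  main := some (entry p)
  σ := ∀ k, Option (Γ k)
  initialState := fun _ => none
  m
    | some l => code p some none l
    | none => .load (fun _ _ => none) .halt

/-- Initial and halting configurations of `FinTM2` describe their stacks by the left-hand side. -/
theorem dite_eq_update (k₀ : K) (l : List (Γ k₀)) (k : K) :
    (if h : k = k₀ then (by rw [h]; exact l) else []) =
      Function.update (fun k => ([] : List (Γ k))) k₀ l k := by
  by_cases hk : k = k₀
  · subst hk
    simp
  · simp [hk]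

/-- The additional step is taken at the label `none`, which resets the registers as the prescribed
halting configuration demands. -/
theorem Runs.outputsInTime [Fintype K] [∀ k, Fintype (Γ k)] {p : StackProg Γ} {k₀ k₁ : K}
    {l : List (Γ k₀)} {l' : List (Γ k₁)} {t : ℕ}
    (h : Runs p (Function.update (fun _ => []) k₀ l) (Function.update (fun _ => []) k₁ l') t) :
    Nonempty (TM2OutputsInTime (p.toMachine k₀ k₁) l (some l') (t + 1)) := by
  obtain ⟨v, hv⟩ := h.steps (p.toMachine k₀ k₁).m some none (fun l => rfl) (fun _ => none)
  have hv' := hv.trans (Steps.single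
    (b := ⟨none, fun _ => none, Function.update (fun _ => []) k₁ l'⟩) rfl)
  exact hv'.congr (congrArg (TM2.Cfg.mk _ _) (funext (dite_eq_update k₀ l)))
    (congrArg (TM2.Cfg.mk _ _) (funext (dite_eq_update k₁ l')))

end Compile

end StackProg


/-! ### Programs that write matrices -/

/-- The symbols of an adjacency matrix: the bits and the end-of-row marker. -/
abbrev MatSym : Type := Option Bool

/-- The work stacks: two matrices with their unary sizes, the number of rows already processed,
a row, a backup, a temporary stack, and the reversed output. -/
inductive WorkStack : Type
  | mat (i : Bool)
  | num (i : Bool)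
  | done
  | row
  | backup
  | tmp
  | rev
  deriving DecidableEq, Fintype

/-- The alphabets of the stacks: the stack `none` holds the input. -/
def StackSym : Option WorkStack → Type
  | none => MatSym ⊕ MatSym
  | some _ => MatSym

instance stackSymFintype : ∀ k, Fintype (StackSym k)
  | none => inferInstanceAs (Fintype (MatSym ⊕ MatSym))
  | some _ => inferInstanceAs (Fintype MatSym)

/-- The contents of all stacks, given the contents of the input stack and of the work stacks. -/
def allStacks (l : List (MatSym ⊕ MatSym)) (w : WorkStack → List MatSym) : ∀ k, List (StackSym k)
  | none => l
  | some k => w k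

theorem update_allStacks_some (l : List (MatSym ⊕ MatSym)) (w : WorkStack → List MatSym)
    (k : WorkStack) (x : List MatSym) :
    Function.update (allStacks l w) (some k) x = allStacks l (Function.update w k x) := by
  funext k'
  cases k' with
  | none => rfl
  | some k' =>
    by_cases h : k' = k
    · subst h
      exact (Function.update_self (β := fun k => List (StackSym k)) (some k') x _).trans
        (Function.update_self k' x w).symm
    · refine (Function.update_of_ne (β := fun k => List (StackSym k)) (a := some k') (a' := some k)
        (by simpa using h) x _).trans ?_
      exact (Function.update_of_ne h x w).symm

theorem update_allStacks_none (l l' : List (MatSym ⊕ MatSym)) (w : WorkStack → List MatSym) :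
    Function.update (allStacks l w) none l' = allStacks l' w := by
  funext k'
  cases k' with
  | none => rfl
  | some k' =>
    exact Function.update_of_ne (β := fun k => List (StackSym k)) (a := some k') (a' := none)
      (by simp) l' _

/-- Programs on the work stacks and the input stack. -/
abbrev WorkProg : Type := StackProg StackSym

namespace WorkProg

open StackProg WorkStack

/-- Push a symbol on a work stack. -/
def put (k : WorkStack) (x : MatSym) : WorkProg := .push (some k) x

/-- Run a loop that is controlled by a work stack. -/
def loopOn (k : WorkStack) (ends : MatSym → Bool) (body : MatSym → WorkProg) : WorkProg :=
  .loop (some k) ends body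

local infixr:60 " ;; " => StackProg.seq

/-- `Does p w w' t`: started with work stacks `w` and no input, the program `p` ends with work
stacks `w'` within `t` steps. -/
def Does (p : WorkProg) (w w' : WorkStack → List MatSym) (t : ℕ) : Prop :=
  Runs p (allStacks [] w) (allStacks [] w') t

variable {p p₁ p₂ : WorkProg} {w w' w₁ w₂ w₃ : WorkStack → List MatSym} {t t' t₁ t₂ : ℕ}
  {k : WorkStack} {ends : MatSym → Bool} {body : MatSym → WorkProg}

theorem Does.mono (h : Does p w w' t) (ht : t ≤ t') : Does p w w' t' := Runs.mono h ht

theorem Does.congr (h : Does p w w₁ t) (hw : w₁ = w') : Does p w w' t := hw ▸ h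

theorem Does.congr' (h : Does p w w' t) (hw : w₁ = w) : Does p w₁ w' t := hw ▸ h

theorem Does.put (k x) (w) : Does (put k x) w (Function.update w k (x :: w k)) 1 := by
  unfold Does
  rw [← update_allStacks_some]
  exact @Runs.push _ StackSym _ (some k) x _

theorem Does.skip (w) : Does .skip w w 1 := Runs.skip _

theorem Does.seq (h₁ : Does p₁ w₁ w₂ t₁) (h₂ : Does p₂ w₂ w₃ t₂) :
    Does (p₁ ;; p₂) w₁ w₃ (t₁ + t₂) := Runs.seq h₁ h₂

theorem Does.loopOn_nil (h : w k = []) : Does (loopOn k ends body) w w 1 := Runs.loop_nil h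

theorem Does.loopOn_end {x l} (h : w k = x :: l) (hx : ends x = true) :
    Does (loopOn k ends body) w (Function.update w k l) 1 := by
  unfold Does
  rw [← update_allStacks_some]
  exact Runs.loop_end (k := some k) h hx

theorem Does.loopOn_cons {x l} (h : w k = x :: l) (hx : ends x = false)
    (h₁ : Does (body x) (Function.update w k l) w₁ t₁) (h₂ : Does (loopOn k ends body) w₁ w₂ t₂) :
    Does (loopOn k ends body) w w₂ (t₁ + t₂ + 1) := by
  unfold Does at h₁
  rw [← update_allStacks_some] at h₁
  exact Runs.loop_cons (k := some k) h hx h₁ h₂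

/-- The rounds of a loop, indexed by the elements of a list: `F d r` are the stacks when the
rounds `d` have been completed and the rounds `r` remain. -/
theorem Does.loopOn_list {ι : Type*} (F : List ι → List ι → WorkStack → List MatSym)
    (sym : ι → MatSym) (tail : List MatSym) (l : List ι)
    (hk : ∀ d r, l = d ++ r → F d r k = r.map sym ++ tail)
    (hends : ∀ i ∈ l, ends (sym i) = false)
    (hbody : ∀ d i r, l = d ++ i :: r →
      Does (body (sym i)) (Function.update (F d (i :: r)) k (r.map sym ++ tail)) (F (d ++ [i]) r) t)
    (hend : Does (loopOn k ends body) (F l []) w' t') :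
    Does (loopOn k ends body) (F [] l) w' (l.length * (t + 1) + t') := by
  suffices h : ∀ r d, l = d ++ r →
      Does (loopOn k ends body) (F d r) w' (r.length * (t + 1) + t') from h l [] rfl
  intro r
  induction r with
  | nil =>
    intro d hd
    rw [List.append_nil] at hd
    subst hd
    simpa using hend
  | cons i r ih =>
    intro d hd
    have h := ih (d ++ [i]) (by simp [hd])
    refine (Does.loopOn_cons (by rw [hk d _ hd]; rfl) (hends i (by simp [hd]))
      (hbody d i r hd) h).mono ?_
    rw [List.length_cons, Nat.succ_mul]
    omega

/-- Pop all symbols of a stack. -/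
def clear (k : WorkStack) : WorkProg := loopOn k (fun _ => false) fun _ => .skip

theorem Does.clear (k w) : Does (clear k) w (Function.update w k []) (2 * (w k).length + 1) := by
  have h := Does.loopOn_list (k := k) (ends := fun _ => false) (body := fun _ => .skip) (t := 1)
    (fun _ r => Function.update w k r) id [] (w k) (by simp) (by simp)
    (fun d i r _ => (Does.skip _).congr (by simp)) (Does.loopOn_nil (by simp))
  simp only [Function.update_eq_self] at h
  exact h.mono (by omega)

/-- Move the contents of a stack to another one, in reverse order. -/
def move (k k' : WorkStack) : WorkProg := loopOn k (fun _ => false) fun x => WorkProg.put k' x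

theorem Does.move {k k' : WorkStack} (hk : k ≠ k') (w) :
    Does (move k k') w (Function.update (Function.update w k []) k' ((w k).reverse ++ w k'))
      (2 * (w k).length + 1) := by
  have h := Does.loopOn_list (k := k) (ends := fun _ => false) (body := fun x => WorkProg.put k' x)
    (t := 1)
    (fun d r => Function.update (Function.update w k r) k' (d.reverse ++ w k')) id [] (w k)
    (by simp [hk]) (by simp)
    (fun d i r _ => (Does.put _ _ _).congr (by
      funext x
      by_cases h1 : x = k' <;> by_cases h2 : x = k <;> simp_all))
    (Does.loopOn_nil (by simp [hk]))
  simp only [Function.update_eq_self, List.reverse_nil, List.nil_append] at h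
  exact h.mono (by omega)

/-- `Emits p w e t`: with work stacks `w`, the program `p` writes `e` to the reversed output
within `t` steps, and leaves everything else as it was. -/
def Emits (p : WorkProg) (w : WorkStack → List MatSym) (e : List MatSym) (t : ℕ) : Prop :=
  ∀ r, Does p (Function.update w rev r) (Function.update w rev (e.reverse ++ r)) t

theorem Emits.mono {e : List MatSym} (h : Emits p w e t) (ht : t ≤ t') : Emits p w e t' :=
  fun r => (h r).mono ht

theorem Emits.congr {e e' : List MatSym} (h : Emits p w e t) (he : e = e') : Emits p w e' t :=
  he ▸ h

theorem Emits.seq {e₁ e₂ : List MatSym} (h₁ : Emits p₁ w e₁ t₁) (h₂ : Emits p₂ w e₂ t₂) :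
    Emits (p₁ ;; p₂) w (e₁ ++ e₂) (t₁ + t₂) := fun r =>
  ((h₁ r).seq (h₂ _)).congr (by simp)

/-- Write one symbol. -/
theorem Emits.put (x : MatSym) (w) : Emits (put rev x) w [x] 1 := fun r =>
  (Does.put _ _ _).congr (by simp)

/-- Write a fixed word. -/
def word : List MatSym → WorkProg
  | [] => .skip
  | x :: l => put rev x ;; word l

theorem Emits.word (l : List MatSym) (w) : Emits (word l) w l (l.length + 1) := by
  induction l with
  | nil => exact fun r => Does.skip _
  | cons x l ih => exact ((Emits.put x w).seq ih).mono (by simp; omega)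

/-- Write a symbol for every symbol of a stack, from its bottom to its top. -/
def copy (k : WorkStack) (f : MatSym → MatSym) : WorkProg :=
  move k tmp ;; loopOn tmp (fun _ => false) fun x => put k x ;; put rev (f x)

/-- Moving to `tmp` and back reverses twice, so the stack is restored. Reading from the bottom up
also gives a row stored in reverse in its original order. -/
theorem Emits.copy (hk : k ≠ tmp) (hk' : k ≠ rev) (f : MatSym → MatSym) (hw : w tmp = []) :
    Emits (copy k f) w ((w k).reverse.map f) (5 * (w k).length + 2) := by
  intro r
  have h1 := Does.move hk (Function.update w rev r)
  have h2 := Does.loopOn_list (k := tmp) (ends := fun _ => false)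
    (body := fun x => WorkProg.put k x ;; WorkProg.put rev (f x)) (t := 2)
    (fun d s => Function.update (Function.update (Function.update w k d.reverse) tmp s) rev
      ((d.map f).reverse ++ r)) id [] (w k).reverse (by simp) (by simp)
    (fun d x s _ => ((Does.put _ _ _).seq (Does.put _ _ _)).congr (by
      funext y
      rcases eq_or_ne y rev with e1 | e1
      · subst e1; simp [hk'.symm]
      rcases eq_or_ne y tmp with e2 | e2
      · subst e2; simp [hk.symm]
      rcases eq_or_ne y k with e3 | e3
      · subst e3; simp [e1, e2]
      simp [e1, e2, e3]))
    (Does.loopOn_nil (by simp))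
  refine ((h1.congr ?_).seq h2).mono ?_ |>.congr ?_
  · funext y
    rcases eq_or_ne y rev with e1 | e1
    · subst e1; simp [hk'.symm]
    rcases eq_or_ne y tmp with e2 | e2
    · subst e2; simp [hw, hk']
    rcases eq_or_ne y k with e3 | e3
    · subst e3; simp [e1, e2]
    simp [e1, e2, e3]
  · simp [hk']
    omega
  · funext y
    rcases eq_or_ne y rev with e1 | e1
    · subst e1; simp
    rcases eq_or_ne y tmp with e2 | e2
    · subst e2; simp [hw]
    rcases eq_or_ne y k with e3 | e3
    · subst e3; simp [e1, e2]
    simp [e1, e2]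

/-- Move the first row of a matrix to the stack `row`, reversed, and to the backup. -/
def readRow (i : Bool) : WorkProg :=
  loopOn (mat i) (fun x => x.isNone) (fun x => put row x ;; put backup x) ;; put backup none

/-- The end marker is popped by the test that ends the loop, so it is put on the backup separately.
-/
theorem Does.readRow (i : Bool) {ρ tail : List MatSym} (hw : w (mat i) = ρ ++ none :: tail)
    (hρ : none ∉ ρ) :
    Does (readRow i) w (Function.update (Function.update (Function.update w (mat i) tail) row
      (ρ.reverse ++ w row)) backup (none :: (ρ.reverse ++ w backup))) (3 * ρ.length + 2) := by
  have h := Does.loopOn_list (k := mat i) (ends := fun x => x.isNone)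
    (body := fun x => WorkProg.put row x ;; WorkProg.put backup x) (t := 2)
    (fun d s => Function.update (Function.update (Function.update w (mat i) (s ++ none :: tail)) row
      (d.reverse ++ w row)) backup (d.reverse ++ w backup)) id (none :: tail) ρ (by simp)
    (fun x hx => by
      cases x with
      | none => exact absurd hx hρ
      | some x => rfl)
    (fun d x s _ => ((Does.put _ _ _).seq (Does.put _ _ _)).congr (by
      funext y
      rcases y with j | j | _ | _ | _ | _ | _ <;> try simp
      by_cases hj : j = i <;> simp [hj]))
    (Does.loopOn_end (x := none) (l := tail) (by simp) rfl)
  simp only [← hw, Function.update_eq_self, List.reverse_nil, List.nil_append] at h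
  refine ((h.seq (Does.put _ _ _)).mono (by omega)).congr ?_
  funext y
  rcases y with j | j | _ | _ | _ | _ | _ <;> try simp
  by_cases hj : j = i <;> simp [hj]

/-- Write a row for each row of a matrix. -/
def eachRow (i : Bool) (p : WorkProg) : WorkProg :=
  loopOn (num i) (fun _ => false) (fun _ =>
    readRow i ;; p ;; put rev none ;; clear row ;; put done (some true)) ;;
  move backup (mat i) ;; move done (num i)

/-- The counters `done` and `num i` give the numbers of rows before and after the current one, hence
the position of the diagonal. The two final moves restore the matrix and its size. -/
theorem Emits.eachRow {ι : Type*} (i : Bool) (l : List ι) (ρ e : ι → List MatSym) (R : ℕ)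
    (hmat : w (mat i) = l.flatMap fun x => ρ x ++ [none])
    (hnum : w (num i) = List.replicate l.length (some true))
    (hdone : w done = []) (hrow : w row = []) (hbackup : w backup = []) (htmp : w tmp = [])
    (hρ : ∀ x, none ∉ ρ x) (hR : ∀ x ∈ l, (ρ x).length ≤ R)
    (hp : ∀ d x r, l = d ++ x :: r → ∀ w' : WorkStack → List MatSym,
      w' (num i) = List.replicate r.length (some true) →
      w' done = List.replicate d.length (some true) → w' row = (ρ x).reverse →
      w' tmp = [] → w' (num !i) = w (num !i) → Emits p w' (e x) t) :
    Emits (eachRow i p) w (l.flatMap fun x => e x ++ [none])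
      ((l.length + 1) * (7 * R + t + 20)) := by
  intro s
  have h := Does.loopOn_list (k := num i) (ends := fun _ => false)
    (body := fun _ => WorkProg.readRow i ;; p ;; WorkProg.put rev none ;; WorkProg.clear row ;;
      WorkProg.put done (some true)) (t := 5 * R + t + 6)
    -- The loop invariant: the rows `r` are still on the matrix stack, and the rows `d` are on the
    -- backup in reverse.
    (fun d r y => match y with
      | mat j => if j = i then r.flatMap fun x => ρ x ++ [none] else w (mat j)
      | num j => if j = i then List.replicate r.length (some true) else w (num j)
      | done => List.replicate d.length (some true)
      | row => []
      | backup => (d.flatMap fun x => ρ x ++ [none]).reverse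
      | tmp => []
      | rev => (d.flatMap fun x => e x ++ [none]).reverse ++ s) (fun _ => some true) [] l
    (by simp) (by simp)
    (fun d x r hl => by
      refine ((Does.readRow i (ρ := ρ x) (tail := r.flatMap fun x => ρ x ++ [none])
        (by simp) (hρ x)).seq (((hp d x r hl (fun y => match y with
          | mat j => if j = i then r.flatMap fun x => ρ x ++ [none] else w (mat j)
          | num j => if j = i then List.replicate r.length (some true) else w (num j)
          | done => List.replicate d.length (some true)
          | row => (ρ x).reverse
          | backup => ((d ++ [x]).flatMap fun x => ρ x ++ [none]).reverse
          | tmp => []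
          | rev => []) (by simp) rfl rfl rfl (by simp)
          ((d.flatMap fun x => e x ++ [none]).reverse ++ s))).seq
          ((Does.put _ _ _).seq ((Does.clear _ _).seq (Does.put _ _ _))) |>.congr' ?_)
        |>.mono ?_).congr ?_
      · funext y
        rcases y with j | j | _ | _ | _ | _ | _ <;> try simp
        all_goals by_cases hj : j = i <;> simp [hj]
      · have := hR x (by simp [hl])
        simp
        omega
      · funext y
        rcases y with j | j | _ | _ | _ | _ | _ <;> try simp
        rw [← List.replicate_succ, List.replicate_succ'])
    (Does.loopOn_nil (by simp))
  have hlen : (l.flatMap fun x => ρ x ++ [none]).length ≤ l.length * (R + 1) := by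
    rw [List.length_flatMap]
    refine (List.sum_le_card_nsmul _ (R + 1) fun y hy => ?_).trans (by simp)
    obtain ⟨x, hx, rfl⟩ := List.mem_map.1 hy
    simpa using hR x hx
  refine (((Does.congr' h ?_).seq ((Does.move (by simp) _).seq (Does.move (by simp) _))).mono
    ?_).congr ?_
  · funext y
    rcases y with j | j | _ | _ | _ | _ | _ <;> simp [*]
    all_goals
      intro hj
      subst hj
      simp [*]
  · simp at hlen ⊢
    nlinarith
  · funext y
    rcases y with j | j | _ | _ | _ | _ | _ <;> simp [*]
    all_goals by_cases hj : j = i <;> simp [*]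

end WorkProg


/-! ### Counting rows and replacing a matrix by the output. -/

namespace WorkProg

open StackProg WorkStack

local infixr:60 " ;; " => StackProg.seq

/-- The work stacks holding two matrices, their unary sizes, and the reversed output. -/
def matState (m : Bool → List MatSym) (n : Bool → ℕ) (r : List MatSym) : WorkStack → List MatSym
  | mat j => m j
  | num j => List.replicate (n j) (some true)
  | rev => r
  | _ => []

variable {m : Bool → List MatSym} {n : Bool → ℕ} {r e : List MatSym} {p : WorkProg} {t : ℕ}

theorem Emits.does (h : Emits p (matState m n []) e t) :
    Does p (matState m n []) (matState m n e.reverse) t := by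
  have h1 : ∀ r, Function.update (matState m n []) rev r = matState m n r := fun r => by
    funext y
    rcases y with j | j | _ | _ | _ | _ | _ <;> simp [matState]
  simpa [h1] using h []

/-- Count the rows of a matrix. -/
def count (i : Bool) : WorkProg :=
  loopOn (mat i) (fun _ => false) (fun x => put backup x ;;
    if x.isNone then put (num i) (some true) else .skip) ;; move backup (mat i)

theorem Does.count (i : Bool) (hn : n i = 0) : Does (count i) (matState m n r)
    (matState m (Function.update n i ((m i).count none)) r) (5 * (m i).length + 2) := by
  have h := Does.loopOn_list (k := mat i) (ends := fun _ => false)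
    (body := fun x => WorkProg.put backup x ;;
      if x.isNone then WorkProg.put (num i) (some true) else .skip) (t := 2)
    (fun d s => Function.update (matState (Function.update m i s)
      (Function.update n i (d.count none)) r) backup d.reverse) id [] (m i)
    (by simp [matState]) (by simp)
    (fun d x s _ => by
      refine Does.congr ((Does.put _ _ _).seq (t₂ := 1) (w₃ := Function.update (matState
        (Function.update m i s) (Function.update n i ((d ++ [x]).count none)) r) backup
        (d ++ [x]).reverse) ?_) rfl
      cases x with
      | none =>
        refine (Does.put _ _ _).congr ?_
        funext y
        rcases y with j | j | _ | _ | _ | _ | _ <;> try simp [matState]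
        all_goals
          by_cases hj : j = i
          · subst hj
            simp [← List.replicate_succ]
          · simp [hj, matState]
      | some x =>
        refine (Does.skip _).congr ?_
        funext y
        rcases y with j | j | _ | _ | _ | _ | _ <;> try simp [matState]
        all_goals
          by_cases hj : j = i
          · subst hj
            simp
          · simp [hj, matState])
    (Does.loopOn_nil (by simp [matState]))
  refine (((Does.congr' h ?_).seq (Does.move (by simp) _)).mono ?_).congr ?_
  · funext y
    rcases y with j | j | _ | _ | _ | _ | _ <;> simp [matState]
    by_cases hj : j = i
    · subst hj
      simp [hn]
    · simp [hj]
  · simp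
    omega
  · funext y
    rcases y with j | j | _ | _ | _ | _ | _ <;> simp [matState]
    by_cases hj : j = i
    · subst hj
      simp
    · simp [hj, matState]

/-- Replace a matrix by the output. -/
def replace (i : Bool) : WorkProg := clear (mat i) ;; clear (num i) ;; move rev (mat i)

theorem Does.replace (i : Bool) : Does (replace i) (matState m n r)
    (matState (Function.update m i r.reverse) (Function.update n i 0) [])
    (2 * (m i).length + 2 * n i + 2 * r.length + 3) := by
  refine (((Does.clear _ _).seq ((Does.clear _ _).seq (Does.move (by simp) _))).mono ?_).congr ?_
  · simp [matState]
    omega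
  · funext y
    rcases y with j | j | _ | _ | _ | _ | _ <;> simp [matState]
    all_goals by_cases hj : j = i <;> simp [hj, matState]

end WorkProg

/-! ### Matrices over lists of vertices -/

open Classical in
/-- The row of bits given by a predicate on a list. -/
noncomputable def bits {V : Type*} (l : List V) (P : V → Prop) : List MatSym :=
  l.map fun y => some (decide (P y))

/-- The adjacency matrix of a relation with respect to a list of vertices. -/
noncomputable def matrixWord {V : Type*} (l : List V) (A : V → V → Prop) : List MatSym :=
  l.flatMap fun x => bits l (A x) ++ [none]

/-- This allows matrices to be computed blockwise over lists of vertices of any type, without index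
arithmetic. -/
theorem encodeMatrix_get {V : Type*} (l : List V) (A : V → V → Prop) :
    encodeMatrix l.length (fun i j => A (l.get i) (l.get j)) = matrixWord l A := by
  calc
    _ = matrixWord ((List.finRange l.length).map l.get) A := by
      simp only [encodeMatrix, matrixWord, bits, List.flatMap_map, List.map_map, Function.comp_def]
    _ = _ := by rw [List.map_get_finRange]

section Bits

variable {V W : Type*} {P Q : V → Prop} {l l' : List V}

theorem bits_append : bits (l ++ l') P = bits l P ++ bits l' P := by simp [bits]

theorem bits_cons {x : V} : bits (x :: l) P = bits [x] P ++ bits l P := by simp [bits]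

theorem bits_map (f : V → W) (P : W → Prop) : bits (l.map f) P = bits l fun x => P (f x) := by
  simp [bits]

theorem bits_congr (h : ∀ x ∈ l, (P x ↔ Q x)) : bits l P = bits l Q :=
  List.map_congr_left fun x hx => by simp [h x hx]

theorem bits_true (h : ∀ x ∈ l, P x) : bits l P = List.replicate l.length (some true) := by
  rw [bits_congr (Q := fun _ => True) (by simpa using h)]
  simp [bits]

theorem bits_false (h : ∀ x ∈ l, ¬ P x) : bits l P = List.replicate l.length (some false) := by
  rw [bits_congr (Q := fun _ => False) (by simpa using h)]
  simp [bits]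

theorem length_bits : (bits l P).length = l.length := by simp [bits]

theorem none_notMem_bits : none ∉ bits l P := by simp [bits]

theorem bits_not : bits l (fun x => ¬ P x) = (bits l P).map (Option.map not) := by
  simp [bits]

theorem map_const_bits (b : MatSym) : (bits l P).map (fun _ => b) = List.replicate l.length b := by
  simp [bits, Function.comp_def]

theorem length_matrixWord (A : V → V → Prop) :
    (matrixWord l A).length = l.length * (l.length + 1) := by
  simp [matrixWord, List.length_flatMap, length_bits]

end Bits

/-- The two constant blocks have the lengths held by `done` and `num` while `eachRow` treats the row
of `x`. -/
theorem bits_ne {V : Type*} {l d r : List V} {x : V} (hl : l.Nodup) (h : l = d ++ x :: r) :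
    bits l (fun y => x ≠ y) =
      List.replicate d.length (some true) ++ some false :: List.replicate r.length (some true) := by
  subst h
  rw [List.nodup_middle, List.nodup_cons, List.mem_append] at hl
  push Not at hl
  rw [bits_append, bits_cons, bits_true, bits_true (l := r), bits_false]
  · rfl
  · simp
  · rintro y hy rfl
    exact hl.1.2 hy
  · rintro y hy rfl
    exact hl.1.1 hy

theorem bits_eq {V : Type*} {l d r : List V} {x : V} (hl : l.Nodup) (h : l = d ++ x :: r) :
    bits l (fun y => x = y) = List.replicate d.length (some false) ++
      some true :: List.replicate r.length (some false) := by
  have := congrArg (List.map (Option.map not)) (bits_ne hl h)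
  rw [← bits_not] at this
  simpa using this

/-! ### Writing the matrix of the clique. -/

namespace WorkProg

open StackProg WorkStack

local infixr:60 " ;; " => StackProg.seq

variable {m : Bool → List MatSym} {n : Bool → ℕ} {p : WorkProg} {t : ℕ}
  {w : WorkStack → List MatSym}

theorem Emits.rep (k : WorkStack) {N : ℕ} (b : Bool) (hw : w k = List.replicate N (some true))
    (htmp : w tmp = []) (hk : k ≠ tmp := by simp) (hk' : k ≠ rev := by simp) :
    Emits (WorkProg.copy k fun _ => some b) w (List.replicate N (some b)) (5 * N + 2) := by
  simpa [hw] using Emits.copy (w := w) hk hk' (fun _ => some b) htmp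

theorem Emits.copyRow {V : Type*} {l : List V} {P : V → Prop} (f : MatSym → MatSym)
    (hw : w row = (bits l P).reverse) (htmp : w tmp = []) :
    Emits (WorkProg.copy row f) w ((bits l P).map f) (5 * l.length + 2) := by
  simpa [hw, length_bits] using Emits.copy (w := w) (k := row) (by simp) (by simp) f htmp

/-- `eachRow` for an adjacency matrix. -/
theorem Emits.eachRow_matrix {V : Type*} {l : List V} {A : V → V → Prop} (i : Bool)
    (e : V → List MatSym) (hm : m i = matrixWord l A) (hn : n i = l.length)
    (hp : ∀ d x r, l = d ++ x :: r → ∀ w : WorkStack → List MatSym,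
      w (num i) = List.replicate r.length (some true) →
      w done = List.replicate d.length (some true) → w row = (bits l (A x)).reverse →
      w tmp = [] → w (num !i) = List.replicate (n !i) (some true) → Emits p w (e x) t) :
    Emits (WorkProg.eachRow i p) (matState m n []) (l.flatMap fun x => e x ++ [none])
      ((l.length + 1) * (7 * l.length + t + 20)) :=
  Emits.eachRow i l (fun x => bits l (A x)) e l.length hm (by simp [matState, hn]) rfl rfl rfl rfl
    (fun _ => none_notMem_bits) (fun _ _ => length_bits.le) hp

/-- Write the adjacency matrix of the clique of a simple graph. -/
def cliqueRows (i : Bool) : WorkProg :=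
  (word [some false, some true] ;; copy (num i) (fun _ => some false) ;;
    copy (num i) (fun _ => some false) ;; copy (num i) (fun _ => some true) ;; word [none]) ;;
  (word [some false, some false] ;; copy (num i) (fun _ => some false) ;;
    copy (num i) (fun _ => some false) ;; copy (num i) (fun _ => some false) ;; word [none]) ;;
  eachRow i (word [some false, some true] ;; copy row (fun _ => some false) ;; copy row id ;;
    copy done (fun _ => some true) ;; word [some false] ;; copy (num i) (fun _ => some true)) ;;
  eachRow i (word [some false, some false] ;; copy row (Option.map not) ;;
    copy row (fun _ => some false) ;;
    copy done (fun _ => some true) ;; word [some false] ;; copy (num i) (fun _ => some true)) ;;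
  eachRow i (word [some false, some false] ;;
    (copy done (fun _ => some false) ;; word [some true] ;; copy (num i) (fun _ => some false)) ;;
    (copy done (fun _ => some false) ;; word [some true] ;; copy (num i) (fun _ => some false)) ;;
    copy row (fun _ => some false))

end WorkProg

section CliqueMatrix

variable {V : Type*}

open CliqueVertex

/-- The vertices of the clique of a simple graph, listed. -/
def cliqueList (l : List V) : List (CliqueVertex V) :=
  [s, t] ++ l.map a ++ l.map b ++ l.map c

theorem length_cliqueList (l : List V) : (cliqueList l).length = 3 * l.length + 2 := by
  simp [cliqueList]
  omega

theorem nodup_cliqueList {l : List V} (hl : l.Nodup) : (cliqueList l).Nodup := by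
  have h : ∀ f : V → CliqueVertex V, Function.Injective f → (l.map f).Nodup := fun f hf =>
    hl.map hf
  simp only [cliqueList, List.nodup_append, h a fun _ _ h => a.inj h, h b fun _ _ h => b.inj h,
    h c fun _ _ h => c.inj h]
  simp
  rintro x (⟨y, -, rfl⟩ | ⟨y, -, rfl⟩) <;> simp

theorem mem_cliqueList {l : List V} (hl : ∀ x, x ∈ l) (x : CliqueVertex V) : x ∈ cliqueList l := by
  cases x <;> simp [cliqueList, hl]

theorem bits_cliqueList (l : List V) (P : CliqueVertex V → Prop) :
    bits (cliqueList l) P = bits [s, t] P ++ (bits l (fun x => P (a x)) ++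
      (bits l (fun x => P (b x)) ++ bits l (fun x => P (c x)))) := by
  simp only [cliqueList, bits_append, bits_map, List.append_assoc]

theorem matrixWord_cliqueList (l : List V) (A : CliqueVertex V → CliqueVertex V → Prop) :
    matrixWord (cliqueList l) A = (bits (cliqueList l) (A s) ++ [none]) ++
      ((bits (cliqueList l) (A t) ++ [none]) ++
        ((l.flatMap fun x => bits (cliqueList l) (A (a x)) ++ [none]) ++
          ((l.flatMap fun x => bits (cliqueList l) (A (b x)) ++ [none]) ++
            (l.flatMap fun x => bits (cliqueList l) (A (c x)) ++ [none])))) := by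
  rw [matrixWord]
  conv_lhs => enter [2]; rw [cliqueList]
  simp [List.flatMap_append, List.flatMap_map]

variable {G : SimpleGraph V} {x y : V}

theorem cliqueArc_ac : CliqueArc G (a x) (c y) ↔ x ≠ y :=
  ⟨fun h => by cases h; assumption, .ac _ _⟩

theorem cliqueArc_bc : CliqueArc G (b x) (c y) ↔ x ≠ y :=
  ⟨fun h => by cases h; assumption, .bc _ _⟩

theorem cliqueArc_ab : CliqueArc G (a x) (b y) ↔ G.Adj x y :=
  ⟨fun h => by cases h; assumption, .ab _ _⟩

theorem cliqueArc_ba : CliqueArc G (b x) (a y) ↔ ¬ G.Adj x y :=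
  ⟨fun h => by cases h; assumption, .ba _ _⟩

theorem cliqueArc_ca : CliqueArc G (c x) (a y) ↔ x = y :=
  ⟨fun h => by cases h; rfl, fun h => h ▸ .ca _⟩

theorem cliqueArc_cb : CliqueArc G (c x) (b y) ↔ x = y :=
  ⟨fun h => by cases h; rfl, fun h => h ▸ .cb _⟩

theorem bits_s_t {V : Type*} (P : CliqueVertex V → Prop) (p q : Bool) (hs : P s ↔ p = true)
    (ht : P t ↔ q = true) : bits [s, t] P = [some p, some q] := by
  simp [bits, hs, ht]

end CliqueMatrix

namespace WorkProg

open StackProg WorkStack CliqueVertex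

variable {m : Bool → List MatSym} {n : Bool → ℕ} {V : Type*} {l : List V}

/-- Each block of a row is constant, a row of `G`, its complement, or a diagonal pattern. Linear
time per row gives the quadratic bound. -/
theorem cliqueRows_emits (i : Bool) (G : SimpleGraph V) (hl : l.Nodup)
    (hm : m i = matrixWord l G.Adj) (hn : n i = l.length) :
    Emits (cliqueRows i) (matState m n []) (matrixWord (cliqueList l) (CliqueArc G))
      (200 * (l.length + 1) ^ 2) := by
  have hnum : matState m n [] (num i) = List.replicate l.length (some true) := by
    simp [matState, hn]
  rw [matrixWord_cliqueList]
  refine Emits.mono (Emits.seq (Emits.congr ((Emits.word _ _).seq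
    ((Emits.rep (num i) false hnum rfl).seq ((Emits.rep (num i) false hnum rfl).seq
      ((Emits.rep (num i) true hnum rfl).seq (Emits.word _ _))))) ?_)
    (Emits.seq (Emits.congr ((Emits.word _ _).seq
    ((Emits.rep (num i) false hnum rfl).seq ((Emits.rep (num i) false hnum rfl).seq
      ((Emits.rep (num i) false hnum rfl).seq (Emits.word _ _))))) ?_)
    (Emits.seq (Emits.eachRow_matrix (t := 20 * l.length + 30) i _ hm hn
      fun d x r hd w h1 h2 h3 h4 _ =>
      (Emits.congr ((Emits.word _ _).seq ((Emits.copyRow _ h3 h4).seq ((Emits.copyRow _ h3 h4).seq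
        ((Emits.rep done _ h2 h4).seq ((Emits.word _ _).seq (Emits.rep (num i) _ h1 h4)))))) ?_
          ).mono ?_)
    (Emits.seq (Emits.eachRow_matrix (t := 20 * l.length + 30) i _ hm hn
      fun d x r hd w h1 h2 h3 h4 _ =>
      (Emits.congr ((Emits.word _ _).seq ((Emits.copyRow _ h3 h4).seq ((Emits.copyRow _ h3 h4).seq
        ((Emits.rep done _ h2 h4).seq ((Emits.word _ _).seq (Emits.rep (num i) _ h1 h4)))))) ?_
          ).mono ?_)
    (Emits.eachRow_matrix (t := 20 * l.length + 30) i _ hm hn fun d x r hd w h1 h2 h3 h4 _ =>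
      (Emits.congr ((Emits.word _ _).seq
        (((Emits.rep done _ h2 h4).seq ((Emits.word _ _).seq (Emits.rep (num i) _ h1 h4))).seq
        (((Emits.rep done _ h2 h4).seq ((Emits.word _ _).seq (Emits.rep (num i) _ h1 h4))).seq
        (Emits.copyRow _ h3 h4)))) ?_).mono ?_))))) ?_
  · rw [bits_cliqueList, bits_s_t _ false true (by simp; nofun) (by simp; exact .st),
      bits_false (l := l), bits_false (l := l), bits_true (l := l)]
    · simp
    · exact fun x _ => .sc x
    · exact fun _ _ => nofun
    · exact fun _ _ => nofun
  · rw [bits_cliqueList, bits_s_t _ false false (by simp; nofun) (by simp; nofun),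
      bits_false (l := l), bits_false (l := l), bits_false (l := l)]
    · simp only [List.cons_append, List.nil_append, List.append_assoc]
    · exact fun _ _ => nofun
    · exact fun _ _ => nofun
    · exact fun _ _ => nofun
  · rw [bits_cliqueList, bits_s_t _ false true (by simp; nofun) (by simp; exact .ta _),
      bits_false (l := l) (P := fun y => CliqueArc G (a x) (a y))]
    · simp only [cliqueArc_ab, cliqueArc_ac, bits_ne hl hd, map_const_bits, List.map_id]
      simp
    · exact fun _ _ => nofun
  · have := congrArg List.length hd
    simp at this ⊢
    omega
  · rw [bits_cliqueList, bits_s_t _ false false (by simp; nofun) (by simp; nofun),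
      bits_false (l := l) (P := fun y => CliqueArc G (b x) (b y))]
    · simp only [cliqueArc_ba, cliqueArc_bc, bits_ne hl hd, map_const_bits, bits_not]
      simp
    · exact fun _ _ => nofun
  · have := congrArg List.length hd
    simp at this ⊢
    omega
  · rw [bits_cliqueList, bits_s_t _ false false (by simp; nofun) (by simp; nofun),
      bits_false (l := l) (P := fun y => CliqueArc G (c x) (c y))]
    · simp only [cliqueArc_ca, cliqueArc_cb, bits_eq hl hd, map_const_bits]
      simp
    · exact fun _ _ => nofun
  · have := congrArg List.length hd
    simp at this ⊢
    omega
  · simp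
    nlinarith

end WorkProg

/-! ### Writing the matrix of the gadget. -/

namespace WorkProg

open StackProg WorkStack

local infixr:60 " ;; " => StackProg.seq

/-- Write a row of the gadget that belongs to a vertex of `J` or to the vertex `q`. -/
def constRow (b₁ b₂ b₂' : Bool) (l : List MatSym) : WorkProg :=
  copy (num false) (fun _ => some b₁) ;; copy (num true) (fun _ => some b₂) ;;
    copy (num true) (fun _ => some b₂') ;; word l ;; word [none]

/-- A word of bits. -/
def bitWord (l : List Bool) : List MatSym := l.map some

/-- Write the adjacency matrix of the gadget. -/
def gadgetRows : WorkProg :=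
  eachRow false (copy row id ;; copy (num true) (fun _ => some true) ;;
    copy (num true) (fun _ => some false) ;;
    word (bitWord [true, false, false, false, false, false])) ;;
  eachRow true (copy (num false) (fun _ => some false) ;; copy row id ;;
    copy row (fun _ => some true) ;;
    word (bitWord [true, false, false, false, false, false])) ;;
  eachRow true (copy (num false) (fun _ => some true) ;; copy row (fun _ => some false) ;;
    copy row id ;;
    word (bitWord [true, false, false, false, false, false])) ;;
  constRow false false false (bitWord [false, true, true, true, true, true]) ;;
  constRow false false true (bitWord [false, false, false, true, false, false]) ;;
  constRow false false false (bitWord [false, false, false, true, true, false]) ;;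
  constRow false true false (bitWord [false, false, false, false, false, true]) ;;
  constRow false false false (bitWord [false, false, false, false, false, true]) ;;
  constRow true false false (bitWord [false, true, true, false, false, false])

end WorkProg

section GadgetMatrix

variable {V₁ V₂ : Type*}

open GadgetVertex

/-- The vertices of the gadget outside the copies of the two given graphs, listed. -/
def gadgetTail : List (GadgetVertex V₁ V₂) := [q, j .u, j .u', j .v, j .v', j .w]

/-- The vertices of the gadget, listed. -/
def gadgetList (l₁ : List V₁) (l₂ : List V₂) : List (GadgetVertex V₁ V₂) :=
  l₁.map y₁ ++ l₂.map y₂ ++ l₂.map y₂' ++ gadgetTail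

theorem length_gadgetList (l₁ : List V₁) (l₂ : List V₂) :
    (gadgetList l₁ l₂).length = l₁.length + 2 * l₂.length + 6 := by
  simp [gadgetList, gadgetTail]
  omega

theorem nodup_gadgetList {l₁ : List V₁} {l₂ : List V₂} (h₁ : l₁.Nodup) (h₂ : l₂.Nodup) :
    (gadgetList l₁ l₂).Nodup := by
  simp only [gadgetList, List.nodup_append, h₁.map (f := (y₁ : V₁ → GadgetVertex V₁ V₂))
    fun _ _ h => y₁.inj h, h₂.map (f := (y₂ : V₂ → GadgetVertex V₁ V₂)) fun _ _ h => y₂.inj h,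
    h₂.map (f := (y₂' : V₂ → GadgetVertex V₁ V₂)) fun _ _ h => y₂'.inj h]
  simp [gadgetTail]
  refine ⟨?_, ?_⟩
  · rintro x (⟨y, -, rfl⟩ | ⟨y, -, rfl⟩) <;> simp
  · rintro x (⟨y, -, rfl⟩ | ⟨y, -, rfl⟩ | ⟨y, -, rfl⟩) <;> simp

theorem mem_gadgetList {l₁ : List V₁} {l₂ : List V₂} (h₁ : ∀ x, x ∈ l₁) (h₂ : ∀ x, x ∈ l₂)
    (x : GadgetVertex V₁ V₂) : x ∈ gadgetList l₁ l₂ := by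
  rcases x with (_ | _ | _ | _ | _) | _ | x | x | x <;> simp [gadgetList, gadgetTail, h₁, h₂]

theorem bits_gadgetList (l₁ : List V₁) (l₂ : List V₂) (P : GadgetVertex V₁ V₂ → Prop) :
    bits (gadgetList l₁ l₂) P = bits l₁ (fun x => P (y₁ x)) ++ (bits l₂ (fun x => P (y₂ x)) ++
      (bits l₂ (fun x => P (y₂' x)) ++ bits gadgetTail P)) := by
  simp only [gadgetList, bits_append, bits_map, List.append_assoc]

theorem matrixWord_gadgetList (l₁ : List V₁) (l₂ : List V₂)
    (A : GadgetVertex V₁ V₂ → GadgetVertex V₁ V₂ → Prop) :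
    matrixWord (gadgetList l₁ l₂) A =
      (l₁.flatMap fun x => bits (gadgetList l₁ l₂) (A (y₁ x)) ++ [none]) ++
        ((l₂.flatMap fun x => bits (gadgetList l₁ l₂) (A (y₂ x)) ++ [none]) ++
          ((l₂.flatMap fun x => bits (gadgetList l₁ l₂) (A (y₂' x)) ++ [none]) ++
            ((bits (gadgetList l₁ l₂) (A q) ++ [none]) ++
              ((bits (gadgetList l₁ l₂) (A (j .u)) ++ [none]) ++
                ((bits (gadgetList l₁ l₂) (A (j .u')) ++ [none]) ++
                  ((bits (gadgetList l₁ l₂) (A (j .v)) ++ [none]) ++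
                    ((bits (gadgetList l₁ l₂) (A (j .v')) ++ [none]) ++
                      (bits (gadgetList l₁ l₂) (A (j .w)) ++ [none])))))))) := by
  rw [matrixWord]
  conv_lhs => enter [2]; rw [gadgetList]
  simp [List.flatMap_append, List.flatMap_map, gadgetTail]

theorem bits_gadgetTail (P : GadgetVertex V₁ V₂ → Prop) (b₀ b₁ b₂ b₃ b₄ b₅ : Bool)
    (h₀ : P q ↔ b₀ = true) (h₁ : P (j .u) ↔ b₁ = true) (h₂ : P (j .u') ↔ b₂ = true)
    (h₃ : P (j .v) ↔ b₃ = true) (h₄ : P (j .v') ↔ b₄ = true) (h₅ : P (j .w) ↔ b₅ = true) :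
    bits gadgetTail P = WorkProg.bitWord [b₀, b₁, b₂, b₃, b₄, b₅] := by
  simp [bits, gadgetTail, WorkProg.bitWord, h₀, h₁, h₂, h₃, h₄, h₅]

theorem bits_const {V : Type*} {l : List V} {P : V → Prop} (b : Bool)
    (h : ∀ x, P x ↔ b = true) : bits l P = List.replicate l.length (some b) := by
  cases b
  · exact bits_false fun x _ hx => by simpa using (h x).1 hx
  · exact bits_true fun x _ => (h x).2 rfl

variable {G₁ : OrientedGraph V₁} {G₂ : OrientedGraph V₂}

theorem gadgetArc_y₁ {a b : V₁} : GadgetArc G₁ G₂ (y₁ a) (y₁ b) ↔ G₁.Adj a b :=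
  ⟨fun h => by cases h; assumption, .inG₁ _ _⟩

theorem gadgetArc_y₂ {a b : V₂} : GadgetArc G₁ G₂ (y₂ a) (y₂ b) ↔ G₂.Adj a b :=
  ⟨fun h => by cases h; assumption, .inG₂ _ _⟩

theorem gadgetArc_y₂' {a b : V₂} : GadgetArc G₁ G₂ (y₂' a) (y₂' b) ↔ G₂.Adj a b :=
  ⟨fun h => by cases h; assumption, .inG₂' _ _⟩

theorem gadgetArc_j {x y : JVertex} : GadgetArc G₁ G₂ (j x) (j y) ↔ JArc x y :=
  ⟨fun h => by cases h; assumption, .inJ _ _⟩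

theorem iff_true_bit {p : Prop} (h : p) : p ↔ true = true := by simpa

theorem iff_false_bit {p : Prop} (h : ¬ p) : p ↔ false = true := by simpa

end GadgetMatrix

namespace WorkProg

open StackProg WorkStack GadgetVertex

variable {m : Bool → List MatSym} {n : Bool → ℕ} {V₁ V₂ : Type*} {l₁ : List V₁} {l₂ : List V₂}
  {G₁ : OrientedGraph V₁} {G₂ : OrientedGraph V₂}

theorem Emits.constRow (b₁ b₂ b₂' c₀ c₁ c₂ c₃ c₄ c₅ : Bool) (P : GadgetVertex V₁ V₂ → Prop)
    (hn₁ : n false = l₁.length) (hn₂ : n true = l₂.length)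
    (h₁ : ∀ x, P (y₁ x) ↔ b₁ = true) (h₂ : ∀ x, P (y₂ x) ↔ b₂ = true)
    (h₂' : ∀ x, P (y₂' x) ↔ b₂' = true) (hc₀ : P q ↔ c₀ = true) (hc₁ : P (j .u) ↔ c₁ = true)
    (hc₂ : P (j .u') ↔ c₂ = true) (hc₃ : P (j .v) ↔ c₃ = true) (hc₄ : P (j .v') ↔ c₄ = true)
    (hc₅ : P (j .w) ↔ c₅ = true) :
    Emits (constRow b₁ b₂ b₂' (bitWord [c₀, c₁, c₂, c₃, c₄, c₅])) (matState m n [])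
      (bits (gadgetList l₁ l₂) P ++ [none]) (5 * l₁.length + 10 * l₂.length + 20) := by
  refine (Emits.congr ((Emits.rep (num false) b₁ rfl rfl).seq
    ((Emits.rep (num true) b₂ rfl rfl).seq ((Emits.rep (num true) b₂' rfl rfl).seq
      ((Emits.word _ _).seq (Emits.word _ _))))) ?_).mono ?_
  · rw [bits_gadgetList, bits_const _ h₁, bits_const _ h₂, bits_const _ h₂',
      bits_gadgetTail P _ _ _ _ _ _ hc₀ hc₁ hc₂ hc₃ hc₄ hc₅, hn₁, hn₂]
    simp only [List.append_assoc]
  · simp [bitWord, hn₁, hn₂]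
    omega

/-- While the rows of the second matrix are treated, `num true` serves as the loop counter and is
partly consumed; constant blocks of the length of `l₂` are then written from `row`. -/
theorem gadgetRows_emits (hm₁ : m false = matrixWord l₁ G₁.Adj)
    (hm₂ : m true = matrixWord l₂ G₂.Adj) (hn₁ : n false = l₁.length) (hn₂ : n true = l₂.length) :
    Emits gadgetRows (matState m n []) (matrixWord (gadgetList l₁ l₂) (GadgetArc G₁ G₂))
      (400 * (l₁.length + l₂.length + 1) ^ 2) := by
  rw [matrixWord_gadgetList]
  refine Emits.mono (Emits.seq (Emits.eachRow_matrix (t := 10 * l₁.length + 10 * l₂.length + 30)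
      false _ hm₁ hn₁ fun d x r hd w h1 h2 h3 h4 h5 =>
      (Emits.congr ((Emits.copyRow _ h3 h4).seq ((Emits.rep (num true) _ h5 h4).seq
        ((Emits.rep (num true) _ h5 h4).seq (Emits.word _ _)))) ?_).mono ?_)
    (Emits.seq (Emits.eachRow_matrix (t := 10 * l₁.length + 10 * l₂.length + 30)
      true _ hm₂ hn₂ fun d x r hd w h1 h2 h3 h4 h5 =>
      (Emits.congr ((Emits.rep (num false) _ h5 h4).seq ((Emits.copyRow _ h3 h4).seq
        ((Emits.copyRow _ h3 h4).seq (Emits.word _ _)))) ?_).mono ?_)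
    (Emits.seq (Emits.eachRow_matrix (t := 10 * l₁.length + 10 * l₂.length + 30)
      true _ hm₂ hn₂ fun d x r hd w h1 h2 h3 h4 h5 =>
      (Emits.congr ((Emits.rep (num false) _ h5 h4).seq ((Emits.copyRow _ h3 h4).seq
        ((Emits.copyRow _ h3 h4).seq (Emits.word _ _)))) ?_).mono ?_)
    (Emits.seq (Emits.constRow _ _ _ _ _ _ _ _ _ _ hn₁ hn₂ ?_ ?_ ?_ ?_ ?_ ?_ ?_ ?_ ?_)
    (Emits.seq (Emits.constRow _ _ _ _ _ _ _ _ _ _ hn₁ hn₂ ?_ ?_ ?_ ?_ ?_ ?_ ?_ ?_ ?_)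
    (Emits.seq (Emits.constRow _ _ _ _ _ _ _ _ _ _ hn₁ hn₂ ?_ ?_ ?_ ?_ ?_ ?_ ?_ ?_ ?_)
    (Emits.seq (Emits.constRow _ _ _ _ _ _ _ _ _ _ hn₁ hn₂ ?_ ?_ ?_ ?_ ?_ ?_ ?_ ?_ ?_)
    (Emits.seq (Emits.constRow _ _ _ _ _ _ _ _ _ _ hn₁ hn₂ ?_ ?_ ?_ ?_ ?_ ?_ ?_ ?_ ?_)
    (Emits.constRow _ _ _ _ _ _ _ _ _ _ hn₁ hn₂ ?_ ?_ ?_ ?_ ?_ ?_ ?_ ?_ ?_))))))))) ?_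
  · rw [bits_gadgetList,
      bits_const (P := fun y => GadgetArc G₁ G₂ (y₁ x) (y₂ y)) true fun _ =>
        iff_true_bit (.y₁y₂ _ _),
      bits_const (P := fun y => GadgetArc G₁ G₂ (y₁ x) (y₂' y)) false fun _ => iff_false_bit nofun,
      bits_gadgetTail _ true false false false false false (iff_true_bit (.y₁q _))
        (iff_false_bit nofun) (iff_false_bit nofun) (iff_false_bit nofun) (iff_false_bit nofun)
        (iff_false_bit nofun)]
    simp only [gadgetArc_y₁, List.map_id, ← hn₂, Bool.not_false]
  · simp [bitWord, hn₂]
    omega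
  · rw [bits_gadgetList,
      bits_const (P := fun y => GadgetArc G₁ G₂ (y₂ x) (y₂' y)) true fun _ =>
        iff_true_bit (.y₂y₂' _ _),
      bits_const (P := fun y => GadgetArc G₁ G₂ (y₂ x) (y₁ y)) false fun _ => iff_false_bit nofun,
      bits_gadgetTail _ true false false false false false (iff_true_bit (.y₂q _))
        (iff_false_bit nofun) (iff_false_bit nofun) (iff_false_bit nofun) (iff_false_bit nofun)
        (iff_false_bit nofun)]
    simp only [gadgetArc_y₂, List.map_id, ← hn₁, Bool.not_true, map_const_bits]
  · simp [bitWord, hn₁]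
    omega
  · rw [bits_gadgetList,
      bits_const (P := fun y => GadgetArc G₁ G₂ (y₂' x) (y₁ y)) true fun _ =>
        iff_true_bit (.y₂'y₁ _ _),
      bits_const (P := fun y => GadgetArc G₁ G₂ (y₂' x) (y₂ y)) false fun _ => iff_false_bit nofun,
      bits_gadgetTail _ true false false false false false (iff_true_bit (.y₂'q _))
        (iff_false_bit nofun) (iff_false_bit nofun) (iff_false_bit nofun) (iff_false_bit nofun)
        (iff_false_bit nofun)]
    simp only [gadgetArc_y₂', List.map_id, ← hn₁, Bool.not_true, map_const_bits]
  · simp [bitWord, hn₁]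
    omega
  -- These goals are the entries of the six rows for `q` and the vertices of `J`; only the time
  -- bound is left afterwards.
  all_goals try first
    | exact iff_true_bit (gadgetArc_j.2 (by constructor))
    | exact iff_false_bit (gadgetArc_j.not.2 nofun)
    | exact fun _ => iff_true_bit (by constructor)
    | exact iff_true_bit (by constructor)
    | exact fun _ => iff_false_bit nofun
    | exact iff_false_bit nofun
  nlinarith

end WorkProg


/-! ### The complete programs and their machines. -/

namespace WorkProg

open StackProg WorkStack

local infixr:60 " ;; " => StackProg.seq

variable {m : Bool → List MatSym} {V V₁ V₂ : Type*} {l : List V} {l₁ : List V₁} {l₂ : List V₂}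

/-- Replace the adjacency matrix of a simple graph by that of its clique. -/
def cliqueProg (i : Bool) : WorkProg := count i ;; cliqueRows i ;; replace i

/-- Replace two adjacency matrices by that of the gadget. -/
def gadgetProg : WorkProg :=
  count false ;; count true ;; gadgetRows ;; replace false ;; clear (mat true) ;; clear (num true)

/-- Split the input into two matrices. -/
def split : WorkProg :=
  .loop none (fun _ => false) (fun x : MatSym ⊕ MatSym => x.elim (put backup) (put tmp)) ;;
    move backup (mat false) ;; move tmp (mat true)

theorem count_none_matrixWord (A : V → V → Prop) : (matrixWord l A).count none = l.length := by
  rw [← encodeMatrix_get, count_none_encodeMatrix]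

/-- The size counter is back at zero at the end, as the next count of the new matrix requires. -/
theorem cliqueProg_does (i : Bool) (G : SimpleGraph V) (hl : l.Nodup)
    (hm : m i = matrixWord l G.Adj) : Does (cliqueProg i) (matState m 0 [])
      (matState (Function.update m i (matrixWord (cliqueList l) (CliqueArc G))) 0 [])
      (300 * (l.length + 1) ^ 2) := by
  have h1 := Does.count (m := m) (n := 0) (r := []) i rfl
  rw [hm, count_none_matrixWord] at h1
  have h2 := (cliqueRows_emits (n := Function.update 0 i l.length) i G hl hm (by simp)).does
  refine ((h1.seq (h2.seq (Does.replace i))).mono ?_).congr ?_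
  · simp only [length_matrixWord, hm, List.length_reverse, length_cliqueList,
      Function.update_self]
    nlinarith
  · rw [List.reverse_reverse, Function.update_idem]
    congr
    funext j
    by_cases hj : j = i <;> simp [hj]

/-- The final clearing leaves only the output stack occupied, which the halting configuration
requires. -/
theorem gadgetProg_does {G₁ : OrientedGraph V₁} {G₂ : OrientedGraph V₂}
    (hm₁ : m false = matrixWord l₁ G₁.Adj) (hm₂ : m true = matrixWord l₂ G₂.Adj) :
    Does gadgetProg (matState m 0 [])
      (Function.update (fun _ => []) (mat false) (matrixWord (gadgetList l₁ l₂) (GadgetArc G₁ G₂)))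
      (600 * (l₁.length + l₂.length + 1) ^ 2) := by
  have h1 := Does.count (m := m) (n := 0) (r := []) false rfl
  rw [hm₁, count_none_matrixWord] at h1
  have h2 := Does.count (m := m) (n := Function.update 0 false l₁.length) (r := []) true rfl
  rw [hm₂, count_none_matrixWord] at h2
  have h3 := (gadgetRows_emits
    (n := Function.update (Function.update 0 false l₁.length) true l₂.length) hm₁ hm₂
    (by simp) (by simp)).does
  refine ((h1.seq (h2.seq (h3.seq ((Does.replace false).seq
    ((Does.clear _ _).seq (Does.clear _ _)))))).mono ?_).congr ?_
  · simp [length_matrixWord, hm₁, hm₂, length_gadgetList, matState]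
    nlinarith
  · funext y
    rcases y with (_ | _) | (_ | _) | _ | _ | _ | _ | _ <;> simp [matState]

theorem put_runs (k : WorkStack) (x : MatSym) (l : List (MatSym ⊕ MatSym))
    (w : WorkStack → List MatSym) :
    Runs (put k x) (allStacks l w) (allStacks l (Function.update w k (x :: w k))) 1 := by
  rw [← update_allStacks_some]
  exact @Runs.push _ StackSym _ (some k) x _

theorem runs_congr {p : WorkProg} {S : ∀ k, List (StackSym k)} {l : List (MatSym ⊕ MatSym)}
    {w w' : WorkStack → List MatSym} {t : ℕ} (h : Runs p S (allStacks l w) t) (hw : w = w') :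
    Runs p S (allStacks l w') t := hw ▸ h

theorem split_loop_runs (l : List (MatSym ⊕ MatSym)) (w : WorkStack → List MatSym) :
    Runs (.loop none (fun _ => false)
      (fun x : MatSym ⊕ MatSym => x.elim (put backup) (put tmp)) : WorkProg) (allStacks l w)
      (allStacks [] (Function.update (Function.update w backup
        ((l.filterMap Sum.getLeft?).reverse ++ w backup)) tmp
        ((l.filterMap Sum.getRight?).reverse ++ w tmp))) (2 * l.length + 1) := by
  induction l generalizing w with
  | nil =>
    have h : Function.update (Function.update w backup
        (([].filterMap (Sum.getLeft? (α := MatSym) (β := MatSym))).reverse ++ w backup)) tmp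
        (([].filterMap (Sum.getRight? (α := MatSym) (β := MatSym))).reverse ++ w tmp) = w := by
      simp
    rw [h]
    exact Runs.loop_nil (Γ := StackSym) (k := none) rfl
  | cons x l ih =>
    have hpop := update_allStacks_none (x :: l) l w
    cases x with
    | inl x =>
      have h := Runs.loop_cons (Γ := StackSym) (k := none) (S := allStacks (.inl x :: l) w)
        (ends := fun _ => false)
        (body := fun x : MatSym ⊕ MatSym => x.elim (put backup) (put tmp)) rfl rfl
        (by rw [hpop]; exact put_runs backup x l w) (ih _)
      refine runs_congr (h.mono (by simp; omega)) ?_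
      funext y
      cases y <;> simp [List.filterMap_cons]
    | inr x =>
      have h := Runs.loop_cons (Γ := StackSym) (k := none) (S := allStacks (.inr x :: l) w)
        (ends := fun _ => false)
        (body := fun x : MatSym ⊕ MatSym => x.elim (put backup) (put tmp)) rfl rfl
        (by rw [hpop]; exact put_runs tmp x l w) (ih _)
      refine runs_congr (h.mono (by simp; omega)) ?_
      funext y
      cases y <;> simp [List.filterMap_cons]

/-- Distributing the input reverses each matrix, and the two moves reverse them back. -/
theorem split_runs (s₁ s₂ : List MatSym) :
    Runs split (allStacks (s₁.map .inl ++ s₂.map .inr) fun _ => [])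
      (allStacks [] (matState (fun b => bif b then s₂ else s₁) 0 []))
      (4 * (s₁.length + s₂.length) + 3) := by
  have h1 := split_loop_runs (s₁.map .inl ++ s₂.map .inr) fun _ => []
  have h2 : ∀ w, Does (move backup (mat false) ;; move tmp (mat true)) w _ _ := fun w =>
    (Does.move (by simp) w).seq (Does.move (by simp) _)
  have h := (Runs.seq h1 (h2 _)).mono (t' := 4 * (s₁.length + s₂.length) + 3) (by
    simp [Function.comp_def]
    omega)
  refine runs_congr h ?_
  funext y
  rcases y with (_ | _) | (_ | _) | _ | _ | _ | _ | _ <;> simp [matState, Function.comp_def]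

theorem computableInPolyTime {α β : Type} {ea : α → List (MatSym ⊕ MatSym)} {eb : β → List MatSym}
    {f : α → β} (p : WorkProg) (T : Polynomial ℕ)
    (h : ∀ a, Runs p (allStacks (ea a) fun _ => [])
      (allStacks [] (Function.update (fun _ => []) (mat false) (eb (f a))))
      (T.eval (ea a).length)) : Nonempty (TM2ComputableInPolyTime ea eb f) := by
  -- The words are generalised because the machine model relabels input and output through
  -- equivalences, here identities. The summand 1 pays for the halting step.
  have key : ∀ a (l : List (MatSym ⊕ MatSym)) (l' : List MatSym), l = ea a → l' = eb (f a) →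
      Nonempty (TM2OutputsInTime (p.toMachine none (some (mat false))) l (some l')
        ((T + 1).eval (ea a).length)) := by
    rintro a _ _ rfl rfl
    rw [Polynomial.eval_add, Polynomial.eval_one]
    refine Runs.outputsInTime (Γ := StackSym) ?_
    have h1 := h a
    rw [← update_allStacks_some, ← update_allStacks_none []] at h1
    have h2 : allStacks [] (fun _ => []) = fun _ => [] := by
      funext k
      cases k <;> rfl
    rwa [h2] at h1
  exact ⟨{
    tm := p.toMachine none (some (mat false))
    inputAlphabet := Equiv.refl (MatSym ⊕ MatSym)
    outputAlphabet := Equiv.refl MatSym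
    time := T + 1
    outputsFun := fun a => (key a _ _ (List.map_id _) (List.map_id _)).some }⟩

end WorkProg

/-! ### Numbered graphs and correctness of the reductions. -/

open OrientedGraph

/-- The oriented graph induced on a list of vertices, as a graph on `{0, …, n - 1}`. -/
def OrientedGraph.onList {V : Type*} (G : OrientedGraph V) (l : List V) : FinOrientedGraph :=
  ⟨l.length, G.comap l.get⟩

theorem OrientedGraph.onList_isomorphic {V : Type*} (G : OrientedGraph V) {l : List V}
    (hl : l.Nodup) (hmem : ∀ x, x ∈ l) : (G.onList l).2.Isomorphic G := by
  classical
  exact G.comap_isomorphic (hl.getEquivOfForallMemList l hmem)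

theorem encode_onList {V : Type*} (G : OrientedGraph V) (l : List V) :
    encodingFinOrientedGraph.encode (G.onList l) = matrixWord l G.Adj :=
  encodeMatrix_get l G.Adj

/-- The gadget of two oriented graphs, with its vertices numbered. -/
def finGadget (G₁ G₂ : FinOrientedGraph) : FinOrientedGraph :=
  (gadget G₁.2 G₂.2).onList (gadgetList (List.finRange G₁.1) (List.finRange G₂.1))

theorem finGadget_isomorphic (G₁ G₂ : FinOrientedGraph) :
    (finGadget G₁ G₂).2.Isomorphic (gadget G₁.2 G₂.2) :=
  onList_isomorphic _ (nodup_gadgetList (List.nodup_finRange _) (List.nodup_finRange _))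
    (mem_gadgetList List.mem_finRange List.mem_finRange)

/-- The oriented clique of a simple graph, with its vertices numbered. -/
def finClique (G : FinGraph) : FinOrientedGraph :=
  (cliqueGraph G.2).onList (cliqueList (List.finRange G.1))

theorem finClique_isomorphic (G : FinGraph) :
    (finClique G).2.Isomorphic (cliqueGraph G.2) :=
  onList_isomorphic _ (nodup_cliqueList (List.nodup_finRange _)) (mem_cliqueList List.mem_finRange)

/-- The vertices `s` and `t` exist even over the empty graph, so the gadget equivalence applies
without exception. -/
theorem finClique_pos (G : FinGraph) : 0 < (finClique G).1 := by
  simp [finClique, onList, length_cliqueList]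

theorem finClique_isOrientedClique (G : FinGraph) : (finClique G).2.IsOrientedClique :=
  cliqueGraph_isOrientedClique.of_isomorphic (finClique_isomorphic G)

theorem isomorphic_iff_finGadget_homFull (G₁ G₂ : FinOrientedGraph)
    (h₁ : 0 < G₁.1 ∧ G₁.2.IsOrientedClique) (h₂ : 0 < G₂.1 ∧ G₂.2.IsOrientedClique) :
    G₁.2.Isomorphic G₂.2 ↔ (finGadget G₁ G₂).2.HomFull := by
  have : Nonempty (Fin G₁.1) := ⟨⟨0, h₁.1⟩⟩
  have : Nonempty (Fin G₂.1) := ⟨⟨0, h₂.1⟩⟩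
  rw [homFull_congr (finGadget_isomorphic G₁ G₂)]
  exact isomorphic_iff_gadget_homFull h₁.2 h₂.2

theorem finClique_isomorphic_iff (G H : FinGraph) :
    (finClique G).2.Isomorphic (finClique H).2 ↔ Nonempty (G.2 ≃g H.2) := by
  rw [← cliqueGraph_isomorphic_iff]
  exact ⟨fun h => ((finClique_isomorphic G).symm.trans h).trans (finClique_isomorphic H),
    fun h => ((finClique_isomorphic G).trans h).trans (finClique_isomorphic H).symm⟩

/-! ### Polynomial bounds for the two reductions. -/

namespace WorkProg

open StackProg

local infixr:60 " ;; " => StackProg.seq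

theorem split_gadgetProg_runs (G₁ G₂ : FinOrientedGraph) :
    Runs (split ;; gadgetProg) (allStacks ((Computability.encodingProd encodingFinOrientedGraph
        encodingFinOrientedGraph).encode (G₁, G₂)) fun _ => [])
      (allStacks [] (Function.update (fun _ => []) (.mat false)
        (encodingFinOrientedGraph.encode (finGadget G₁ G₂))))
      (((700 : Polynomial ℕ) * (Polynomial.X + 1) ^ 2).eval
        ((Computability.encodingProd encodingFinOrientedGraph
          encodingFinOrientedGraph).encode (G₁, G₂)).length) := by
  have h1 := split_runs (encodingFinOrientedGraph.encode G₁) (encodingFinOrientedGraph.encode G₂)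
  have h2 := gadgetProg_does
    (m := fun b => bif b then encodingFinOrientedGraph.encode G₂
      else encodingFinOrientedGraph.encode G₁) (l₁ := List.finRange G₁.1)
    (l₂ := List.finRange G₂.1) (G₁ := G₁.2) (G₂ := G₂.2) rfl rfl
  -- The encoding of a graph on `n` vertices has length `n * (n + 1)`, so vertex counts are bounded
  -- by input length.
  have e : ∀ G : FinOrientedGraph, G.1 ≤ (encodingFinOrientedGraph.encode G).length := fun G => by
    refine (le_of_le_of_eq ?_ (length_matrixWord (l := List.finRange G.1) G.2.Adj).symm :)
    simp only [List.length_finRange]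
    nlinarith
  have e₁ := e G₁
  have e₂ := e G₂
  rw [finGadget, encode_onList]
  refine (Runs.seq h1 h2).mono ?_
  simp only [List.length_finRange, Computability.encodingProd, List.length_append, List.length_map,
    Polynomial.eval_mul, Polynomial.eval_pow, Polynomial.eval_add, Polynomial.eval_X,
    Polynomial.eval_one, Polynomial.eval_ofNat]
  nlinarith

theorem split_cliqueProg_gadgetProg_runs (G H : FinGraph) :
    Runs (split ;; cliqueProg false ;; cliqueProg true ;; gadgetProg)
      (allStacks ((Computability.encodingProd encodingFinGraph
        encodingFinGraph).encode (G, H)) fun _ => [])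
      (allStacks [] (Function.update (fun _ => []) (.mat false)
        (encodingFinOrientedGraph.encode (finGadget (finClique G) (finClique H)))))
      (((20000 : Polynomial ℕ) * (Polynomial.X + 1) ^ 2).eval
        ((Computability.encodingProd encodingFinGraph
          encodingFinGraph).encode (G, H)).length) := by
  have h1 := split_runs (encodingFinGraph.encode G) (encodingFinGraph.encode H)
  have h2 := cliqueProg_does (m := fun b => bif b then encodingFinGraph.encode H
    else encodingFinGraph.encode G) false G.2 (List.nodup_finRange _) rfl
  have h3 := cliqueProg_does (m := Function.update (fun b => bif b then encodingFinGraph.encode H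
    else encodingFinGraph.encode G) false (matrixWord (cliqueList (List.finRange G.1))
      (CliqueArc G.2))) true H.2 (List.nodup_finRange _) rfl
  have h4 := gadgetProg_does
    (m := Function.update (Function.update (fun b => bif b then encodingFinGraph.encode H
    else encodingFinGraph.encode G) false (matrixWord (cliqueList (List.finRange G.1))
      (CliqueArc G.2))) true (matrixWord (cliqueList (List.finRange H.1)) (CliqueArc H.2)))
    (l₁ := List.finRange (finClique G).1) (l₂ := List.finRange (finClique H).1)
    (G₁ := (finClique G).2) (G₂ := (finClique H).2)
    (encode_onList (cliqueGraph G.2) _).symm (encode_onList (cliqueGraph H.2) _).symm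
  have e : ∀ G : FinGraph, G.1 ≤ (encodingFinGraph.encode G).length := fun G => by
    refine (le_of_le_of_eq ?_ (length_matrixWord (l := List.finRange G.1) G.2.Adj).symm :)
    simp only [List.length_finRange]
    nlinarith
  have e₁ := e G
  have e₂ := e H
  have e₃ : ∀ G : FinGraph, (finClique G).1 = 3 * G.1 + 2 := fun G => by
    simp [finClique, onList, length_cliqueList]
  rw [finGadget, encode_onList]
  refine (Runs.seq h1 (Runs.seq h2 (Runs.seq h3 h4))).mono ?_
  simp only [List.length_finRange, Computability.encodingProd, List.length_append, List.length_map,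
    Polynomial.eval_mul, Polynomial.eval_pow, Polynomial.eval_add, Polynomial.eval_X,
    Polynomial.eval_one, Polynomial.eval_ofNat, e₃]
  -- With `N` the input length, the cliques have at most `3 * N + 4` vertices together. The gadget
  -- stage thus costs at most `600 * (3 * N + 5) ^ 2`, which is at most `15000 * (N + 1) ^ 2`; the
  -- rest of the coefficient covers the other stages.
  nlinarith

end WorkProg

theorem isPolyTimeReduction_gadget : IsPolyTimeReduction OCLIQUEISO HOMFULL
    fun p : OCliquePair => finGadget p.1.1 p.1.2 :=
  ⟨WorkProg.computableInPolyTime _ _ fun p : OCliquePair =>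
      WorkProg.split_gadgetProg_runs p.1.1 p.1.2,
    fun p => isomorphic_iff_finGadget_homFull _ _ p.2.1 p.2.2⟩

theorem giHard_HOMFULL : GIHard HOMFULL :=
  ⟨fun p : FinGraph × FinGraph => finGadget (finClique p.1) (finClique p.2),
    WorkProg.computableInPolyTime _ _ fun p : FinGraph × FinGraph =>
      WorkProg.split_cliqueProg_gadgetProg_runs p.1 p.2,
    fun p => (finClique_isomorphic_iff p.1 p.2).symm.trans
      (isomorphic_iff_finGadget_homFull _ _ ⟨finClique_pos _, finClique_isOrientedClique _⟩
        ⟨finClique_pos _, finClique_isOrientedClique _⟩)⟩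

theorem mainTheorem4 :
    GIHard HOMFULL ∧
    (∃ f : OCliquePair → FinOrientedGraph,
      IsPolyTimeReduction OCLIQUEISO HOMFULL f ∧
      ∀ p : OCliquePair, (f p).2.Isomorphic (gadget p.1.1.2 p.1.2.2)) ∧
    (∀ (V₁ V₂ : Type) [Finite V₁] [Finite V₂] [Nonempty V₁] [Nonempty V₂]
      (G₁ : OrientedGraph V₁) (G₂ : OrientedGraph V₂),
      G₁.IsOrientedClique → G₂.IsOrientedClique →
      (G₁.Isomorphic G₂ ↔ (gadget G₁ G₂).HomFull)) :=
  ⟨giHard_HOMFULL, ⟨_, isPolyTimeReduction_gadget, fun p => finGadget_isomorphic p.1.1 p.1.2⟩,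
    fun _ _ _ _ _ _ _ _ h₁ h₂ => isomorphic_iff_gadget_homFull h₁ h₂⟩
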